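/- Let $\alpha>2$, $\lambda_{\rm p}>0$, $\lambda>0$, $D>0$. Let $\Phi$ be a Matérn cluster process in the plane: the parent points form a homogeneous Poisson point process $\Phi_{\rm p}$ of intensity $\lambda_{\rm p}$ on $\mathbb{R}^2$ and, conditionally on $\Phi_{\rm p}$, the offspring processes $\Phi_{\mathbf x}$, $\mathbf x\in\Phi_{\rm p}$, are independent, $\Phi_{\mathbf x}$ being a Poisson point process of intensity $\lambda$ on the disk of radius $D$ centred at $\mathbf x$; $\Phi=\bigcup_{\mathbf x\in\Phi_{\rm p}}\Phi_{\mathbf x}$. Attach to the points $\mathbf y\in\Phi$ i.i.d. exponential marks $h_{\mathbf y}$ with mean $1$, independent of the locations of all points, and let $$\mathcal I_{\rm inter}=\sum_{\mathbf y\in\Phi}h_{\mathbf y}\|\mathbf y\|^{-\alpha}$$ be the inter-cluster interference at the origin. Then $\mathcal I_{\rm inter}<\infty$ almost surely, and for every real $s>0$ its Laplace transform is $$\mathbb E\bigl[e^{-s\mathcal I_{\rm inter}}\bigr]=\exp\biggl(-2\pi\lambda_{\rm p}\biggl(\int_0^D\bigl\{1-e^{-\lambda f(s,u)}\bigr\}u\,\mathrm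 du+\int_D^\infty\bigl\{1-e^{-\lambda g(s,u)}\bigr\}u\,\mathrm du\biggr)\biggr),$$ where both integrals converge absolutely and $$f(s,u)=\int_0^\pi\mathcal F(s,R_2(u,\theta))\,\mathrm d\theta,\qquad g(s,u)=\int_0^{\varphi_2(u)}\bigl\{\mathcal F(s,R_2(u,\theta))-\mathcal F(s,\hat R_2(u,\theta))\bigr\}\,\mathrm d\theta,$$ with $\varphi_2(u)=\arcsin(D/u)$, $R_2(u,\theta)=u\cos\theta+\sqrt{D^2-u^2\sin^2\theta}$, $\hat R_2(u,\theta)=u\cos\theta-\sqrt{D^2-u^2\sin^2\theta}$, and $$\mathcal F(s,x)=x^2\,{}_2F_1\Bigl(1,\tfrac2\alpha;1+\tfrac2\alpha;-\tfrac{x^\alpha}{s}\Bigr),$$ ${}_2F_1$ being the Gauss hypergeometric function (analytically continued to $\mathbb C\setminus[1,\infty)$). -/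

import Mathlib

open MeasureTheory ProbabilityTheory Set
open scoped ENNReal NNReal

noncomputable section

/-- The Euclidean plane. -/
abbrev Plane : Type := EuclideanSpace ℝ (Fin 2)

/-! ### The Gauss hypergeometric function off the cut `[1, ∞)` -/

/-- The plane cut along the real half-line `[1, ∞)`. -/
def hypergeometricDomain : Set ℂ := {z | 1 - z ∈ Complex.slitPlane}

/-- `G` is holomorphic on the plane cut along `[1, ∞)` and is the sum of the hypergeometric
series with parameters `a, b; c` on the open unit disk. -/
def IsHypergeometricContinuation (a b c : ℂ) (G : ℂ → ℂ) : Prop :=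
  DifferentiableOn ℂ G hypergeometricDomain ∧
    EqOn G (ordinaryHypergeometric a b c) (Metric.ball 0 1)

open Classical in
/-- The Gauss hypergeometric function (principal branch): the analytic continuation of the
hypergeometric series to the plane cut along `[1, ∞)`. -/
def gaussHypergeometric (a b c z : ℂ) : ℂ :=
  if h : ∃ G, IsHypergeometricContinuation a b c G then h.choose z else 0

/-- The continuation is unique, so `gaussHypergeometric` does not depend on the choice made. -/
theorem gaussHypergeometric_eq {a b c : ℂ} {G : ℂ → ℂ}
    (hG : IsHypergeometricContinuation a b c G) :
    EqOn (gaussHypergeometric a b c) G hypergeometricDomain := by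
  classical
  have hex : ∃ G, IsHypergeometricContinuation a b c G := ⟨G, hG⟩
  have hH := hex.choose_spec
  have hopen : IsOpen hypergeometricDomain :=
    Complex.isOpen_slitPlane.preimage (continuous_const.sub continuous_id)
  have h0 : (0 : ℂ) ∈ hypergeometricDomain := by simp [hypergeometricDomain]
  have hstar : StarConvex ℝ 0 hypergeometricDomain := by
    intro z hz p q hp hq hpq
    have h := Complex.starConvex_one_slitPlane hz hp hq hpq
    have e : (1 : ℂ) - (p • (0 : ℂ) + q • z) = p • (1 : ℂ) + q • (1 - z) := by
      have : (p : ℂ) + (q : ℂ) = 1 := by exact_mod_cast hpq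
      simp only [Complex.real_smul]
      linear_combination -this
    change 1 - (p • (0 : ℂ) + q • z) ∈ Complex.slitPlane
    rw [e]
    exact h
  have hpre : IsPreconnected hypergeometricDomain :=
    (hstar.isPathConnected h0).isConnected.isPreconnected
  have key : EqOn hex.choose G hypergeometricDomain := by
    refine (hH.1.analyticOnNhd hopen).eqOn_of_preconnected_of_eventuallyEq
      (hG.1.analyticOnNhd hopen) hpre h0 ?_
    filter_upwards [Metric.ball_mem_nhds (0 : ℂ) one_pos] with z hz
    rw [hH.2 hz, hG.2 hz]
  intro z hz
  rw [gaussHypergeometric, dif_pos hex]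
  exact key hz

/-! ### Point processes -/

section PointProcesses

variable {Ω : Type*} [MeasurableSpace Ω]

/-- The random counting measure `Φ` is a Poisson point process with intensity measure `Λ`:
`Φ(B)` is Poisson with mean `Λ(B)` for every Borel set `B` with `Λ(B) < ∞`, and the numbers of
points in pairwise disjoint Borel sets are independent. -/
structure IsPoissonProcess (P : Measure Ω) (Φ : Ω → Measure Plane) (Λ : Measure Plane) :
    Prop where
  hasLaw_count : ∀ B : Set Plane, MeasurableSet B → Λ B < ∞ →
    HasLaw (fun ω => Φ ω B)
      ((poissonMeasure (Λ B).toNNReal).map (fun n : ℕ => (n : ℝ≥0∞))) P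
  indep_counts : ∀ (m : ℕ) (B : Fin m → Set Plane), (∀ l, MeasurableSet (B l)) →
    Pairwise (fun l l' => Disjoint (B l) (B l')) → iIndepFun (fun l ω => Φ ω (B l)) P

/-- Conditionally on the σ-algebra `𝓖`, the random counting measures `Φ i` are independent, and
`Φ i` is a Poisson point process with the (`𝓖`-measurable) finite intensity measure `Λ i`: the
conditional joint probabilities of the counts of finitely many of the `Φ i` on finitely many
pairwise disjoint Borel sets are products of Poisson probabilities. -/
def IsCondIndepPoisson {ι : Type*} (P : Measure Ω) (𝓖 : MeasurableSpace Ω)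
    (Φ Λ : ι → Ω → Measure Plane) : Prop :=
  ∀ (S : Finset ι) (m : ℕ) (B : Fin m → Set Plane), (∀ l, MeasurableSet (B l)) →
    Pairwise (fun l l' => Disjoint (B l) (B l')) → ∀ k : ι → Fin m → ℕ,
      P⟦{ω | ∀ i ∈ S, ∀ l, Φ i ω (B l) = (k i l : ℝ≥0∞)} | 𝓖⟧ =ᵐ[P]
        fun ω => ∏ i ∈ S, ∏ l, (poissonMeasure (Λ i ω (B l)).toNNReal).real {k i l}

/-- The parent point process, `X i` being the location of the `i`-th parent. -/
def parentProcess (X : ℕ → Ω → Plane) (ω : Ω) : Measure Plane :=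
  Measure.sum fun i => Measure.dirac (X i ω)

/-- The offspring point process of the `i`-th parent, whose points are `Y i j` for
`j < N i`. -/
def offspringProcess (N : ℕ → Ω → ℕ) (Y : ℕ → ℕ → Ω → Plane) (i : ℕ) (ω : Ω) :
    Measure Plane :=
  ∑ j ∈ Finset.range (N i ω), Measure.dirac (Y i j ω)

/-- A Matérn cluster process, given through measurable enumerations of its points: the parents
`X i` form a homogeneous Poisson process of intensity `lamP` on the plane; the `i`-th parent has
the `N i` offspring `Y i j`, `j < N i`; and, conditionally on the parents, the offspring
processes are independent, that of the parent at `x` being a Poisson process of intensity `lam`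
on the disk of radius `D` around `x`. -/
structure IsMaternClusterProcess (P : Measure Ω) (lamP lam D : ℝ) (X : ℕ → Ω → Plane)
    (N : ℕ → Ω → ℕ) (Y : ℕ → ℕ → Ω → Plane) : Prop where
  measurable_parent : ∀ i, Measurable (X i)
  measurable_num : ∀ i, Measurable (N i)
  measurable_offspring : ∀ i j, Measurable (Y i j)
  parents : IsPoissonProcess P (parentProcess X) (ENNReal.ofReal lamP • volume)
  offspring : IsCondIndepPoisson P
    (MeasurableSpace.comap (fun ω i => X i ω) MeasurableSpace.pi)
    (offspringProcess N Y)
    (fun i ω => ENNReal.ofReal lam • volume.restrict (Metric.closedBall (X i ω) D))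

/-- Rayleigh fading: the power gains `h i j` (of the `j`-th transmitter in the `i`-th cluster)
are i.i.d. exponential with mean one and independent of the locations of all nodes. -/
structure IsRayleighFading (P : Measure Ω) (X : ℕ → Ω → Plane) (N : ℕ → Ω → ℕ)
    (Y : ℕ → ℕ → Ω → Plane) (h : ℕ → ℕ → Ω → ℝ) : Prop where
  measurable_gain : ∀ i j, Measurable (h i j)
  hasLaw_gain : ∀ i j, HasLaw (h i j) (expMeasure 1) P
  indep_gains : iIndepFun (fun (q : ℕ × ℕ) ω => h q.1 q.2 ω) P
  indep_locations : IndepFun (fun ω (q : ℕ × ℕ) => h q.1 q.2 ω)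
    (fun ω => ((fun i => X i ω), (fun i => N i ω), (fun q : ℕ × ℕ => Y q.1 q.2 ω))) P

/-- The interference at the origin caused by all points of the cluster process: the sum of
`h_y ‖y‖ ^ (-α)` over the transmitters `y`, as an element of `[0, ∞]`. -/
def interCluster (α : ℝ) (N : ℕ → Ω → ℕ) (Y : ℕ → ℕ → Ω → Plane) (h : ℕ → ℕ → Ω → ℝ)
    (ω : Ω) : ℝ≥0∞ :=
  ∑' i, ∑ j ∈ Finset.range (N i ω), ENNReal.ofReal (h i j ω) * ‖Y i j ω‖ₑ ^ (-α)

end PointProcesses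

/-! ### The functions in the Laplace transform -/

/-- `F(s, x) = x² ₂F₁(1, 2/α; 1 + 2/α; -x^α / s)`; the hypergeometric value is real. -/
def pathF (α s x : ℝ) : ℝ :=
  x ^ 2 * (gaussHypergeometric 1 ((2 / α : ℝ) : ℂ) ((1 + 2 / α : ℝ) : ℂ)
    ((-(1 / s) * x ^ α : ℝ) : ℂ)).re

/-- `R₂(u, θ) = u cos θ + √(D² - u² sin² θ)`. -/
def farRadius (D u θ : ℝ) : ℝ :=
  u * Real.cos θ + Real.sqrt (D ^ 2 - u ^ 2 * Real.sin θ ^ 2)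

/-- `R̂₂(u, θ) = u cos θ - √(D² - u² sin² θ)`. -/
def nearRadius (D u θ : ℝ) : ℝ :=
  u * Real.cos θ - Real.sqrt (D ^ 2 - u ^ 2 * Real.sin θ ^ 2)

/-- `f(s, u) = ∫₀^π F(s, R₂(u, θ)) dθ`. -/
def insideExponent (α D s u : ℝ) : ℝ :=
  ∫ θ in (0 : ℝ)..Real.pi, pathF α s (farRadius D u θ)

/-- `g(s, u) = ∫₀^{arcsin (D/u)} (F(s, R₂(u, θ)) - F(s, R̂₂(u, θ))) dθ`. -/
def outsideExponent (α D s u : ℝ) : ℝ :=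
  ∫ θ in (0 : ℝ)..Real.arcsin (D / u),
    (pathF α s (farRadius D u θ) - pathF α s (nearRadius D u θ))

end

/-! All expectations are first computed in `[0, ∞]`, with `expNeg` in place of the real exponential,
so no finiteness or integrability is needed until the end.

The randomness is averaged out in three layers. For fixed locations the fading gives `𝔼 exp (-s h r
^ (-α)) = 1 / (1 + s r ^ (-α))`, so the Laplace transform of the interference is a Laplace
functional of the offspring (`IsRayleighFading.lintegral_expNeg_interCluster`). A Poisson process
with intensity measure `Λ` satisfies `𝔼 exp (-∑ w) = exp (-∫ (1 - exp (-w)) dΛ)`. The conditional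
version (`IsCondIndepPoisson.lintegral_expNeg`) turns each cluster into a function `W =
clusterExponent` of its parent; the version for the parents (`IsPoissonProcess.lintegral_expNeg`)
then gives `exp (-lamP ∫ (1 - exp (-W)))`.

The rest is geometry. In polar coordinates about the origin, `W` integrates `r / (1 + r ^ α / s)`
along the chords that rays from the origin cut out of the disk. A primitive of this kernel is half
of `pathF`, by Euler's integral for the hypergeometric function. The chord starts at the origin if
the disk contains it and at `nearRadius` otherwise, whence `f` and `g`. As `W` is radial, the
integral over parents becomes `2π ∫ u du`.

Finiteness rests on `∫ W < ∞`, where `α > 2` enters: as `s → 0` this integral vanishes, so the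
transform tends to one, which forces the interference to be almost surely finite. -/

noncomputable section

open Filter Topology

/-! ### The exponential function on `[0, ∞]` -/

/-- The function `z ↦ exp (-z)` on `[0, ∞]`. -/
def expNeg (z : ℝ≥0∞) : ℝ≥0∞ := EReal.exp (-(z : EReal))

lemma expNeg_eq_inv (z : ℝ≥0∞) : expNeg z = (EReal.exp z)⁻¹ := EReal.exp_neg _

@[simp] lemma expNeg_zero : expNeg 0 = 1 := by simp [expNeg]

@[simp] lemma expNeg_top : expNeg ∞ = 0 := by simp [expNeg]

lemma expNeg_ofReal {x : ℝ} (hx : 0 ≤ x) :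
    expNeg (ENNReal.ofReal x) = ENNReal.ofReal (Real.exp (-x)) := by
  rw [expNeg, EReal.coe_ennreal_ofReal, max_eq_left hx, ← EReal.coe_neg, EReal.exp_coe]

lemma expNeg_add (y z : ℝ≥0∞) : expNeg (y + z) = expNeg y * expNeg z := by
  rw [expNeg_eq_inv, expNeg_eq_inv, expNeg_eq_inv, EReal.coe_ennreal_add, EReal.exp_add,
    ENNReal.mul_inv]
  · left; simp
  · right; simp

lemma expNeg_sum {ι : Type*} (S : Finset ι) (z : ι → ℝ≥0∞) :
    expNeg (∑ i ∈ S, z i) = ∏ i ∈ S, expNeg (z i) := by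
  classical
  induction S using Finset.induction_on with
  | empty => simp
  | insert i S hi ih => rw [Finset.sum_insert hi, Finset.prod_insert hi, expNeg_add, ih]

lemma expNeg_mul_natCast (z : ℝ≥0∞) (n : ℕ) : expNeg (z * n) = expNeg z ^ n := by
  induction n with
  | zero => simp
  | succ n ih => rw [Nat.cast_succ, mul_add, mul_one, expNeg_add, ih, pow_succ]

lemma continuous_expNeg : Continuous expNeg :=
  ENNReal.continuous_exp.comp (continuous_neg.comp continuous_coe_ennreal_ereal)

@[fun_prop]
lemma measurable_expNeg : Measurable expNeg := continuous_expNeg.measurable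

lemma antitone_expNeg : Antitone expNeg := fun _ _ h =>
  EReal.exp_monotone (EReal.neg_le_neg_iff.2 (EReal.coe_ennreal_le_coe_ennreal_iff.2 h))

lemma expNeg_le_one (z : ℝ≥0∞) : expNeg z ≤ 1 := by
  simpa using antitone_expNeg (zero_le (a := z))

lemma expNeg_ne_top (z : ℝ≥0∞) : expNeg z ≠ ∞ := ((expNeg_le_one z).trans_lt (by simp)).ne

lemma one_sub_expNeg_le (z : ℝ≥0∞) : 1 - expNeg z ≤ z := by
  rcases eq_or_ne z ∞ with rfl | hz
  · simp
  rw [← ENNReal.ofReal_toReal hz, expNeg_ofReal ENNReal.toReal_nonneg, ← ENNReal.ofReal_one,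
    ← ENNReal.ofReal_sub _ (Real.exp_pos _).le]
  exact ENNReal.ofReal_le_ofReal (by linarith [Real.add_one_le_exp (-z.toReal)])

/-- For `1 ≤ a` the logarithm is nonnegative, so `toENNReal` truncates nothing; `a = ∞` is included.
-/
lemma expNeg_toENNReal_log {a : ℝ≥0∞} (ha : 1 ≤ a) :
    expNeg (ENNReal.log a).toENNReal = a⁻¹ := by
  rw [expNeg_eq_inv, EReal.coe_toENNReal, ENNReal.exp_log]
  simpa using ENNReal.log_monotone ha

/-- The Laplace transform of the Poisson distribution. -/
lemma lintegral_expNeg_poissonMeasure (r : ℝ≥0) (c : ℝ≥0∞) :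
    ∫⁻ n : ℕ, expNeg (c * n) ∂poissonMeasure r = expNeg ((1 - expNeg c) * r) := by
  obtain ⟨t, ht⟩ : ∃ t : ℝ≥0, (t : ℝ≥0∞) = expNeg c := ⟨_, ENNReal.coe_toNNReal (expNeg_ne_top c)⟩
  have ht1 : (t : ℝ) ≤ 1 := by
    have := expNeg_le_one c
    rw [← ht] at this
    exact_mod_cast this
  have hr : (1 - expNeg c) * r = ENNReal.ofReal ((1 - t) * r : ℝ) := by
    rw [ENNReal.ofReal_mul (by linarith), ENNReal.ofReal_sub _ (by positivity), ← ht]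
    simp
  rw [hr, expNeg_ofReal (mul_nonneg (sub_nonneg.2 ht1) r.coe_nonneg), lintegral_countable']
  have hs : HasSum (fun n : ℕ => Real.exp (-r) * ((t * r : ℝ) ^ n / n.factorial))
      (Real.exp (-r) * Real.exp (t * r)) := by
    have := NormedSpace.expSeries_div_hasSum_exp (t * r : ℝ)
    rw [← Real.exp_eq_exp_ℝ] at this
    exact this.mul_left _
  rw [show -((1 - (t : ℝ)) * r) = -r + t * r by ring, Real.exp_add, ← hs.tsum_eq,
    ENNReal.ofReal_tsum_of_nonneg (fun n => by positivity) hs.summable]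
  refine tsum_congr fun n => ?_
  rw [expNeg_mul_natCast, poissonMeasure_singleton, ← ht, ← ENNReal.coe_pow,
    ← ENNReal.ofReal_coe_nnreal, ← ENNReal.ofReal_mul (by positivity)]
  congr 1
  push_cast
  ring

/-! ### Laplace functional of a Poisson process -/

/-- The level sets of a simple function, as a finite sequence of pairwise disjoint sets. -/
lemma MeasureTheory.SimpleFunc.exists_lintegral_comp_eq_sum {E : Type*} [MeasurableSpace E]
    (φ : SimpleFunc E ℝ≥0∞) :
    ∃ (m : ℕ) (c : Fin m → ℝ≥0∞), (∀ l, c l ≠ 0) ∧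
      Pairwise (fun l l' => Disjoint (φ ⁻¹' {c l}) (φ ⁻¹' {c l'})) ∧
      ∀ (F : ℝ≥0∞ → ℝ≥0∞), F 0 = 0 → ∀ μ : Measure E,
        ∫⁻ x, F (φ x) ∂μ = ∑ l, F (c l) * μ (φ ⁻¹' {c l}) := by
  classical
  -- The value zero is dropped because its level set may have infinite measure; `F 0 = 0` makes this
  -- harmless.
  set R := φ.range.filter (· ≠ 0) with hR
  let e := R.equivFin.symm
  refine ⟨R.card, fun l => (e l : ℝ≥0∞), fun l => (Finset.mem_filter.1 (e l).2).2, ?_, ?_⟩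
  · intro l l' hl
    refine Disjoint.preimage _ (disjoint_singleton.2 fun h => hl ?_)
    exact e.injective (Subtype.ext h)
  · intro F hF μ
    have h1 : ∫⁻ x, F (φ x) ∂μ = ∑ c ∈ φ.range, F c * μ (φ ⁻¹' {c}) := by
      rw [← SimpleFunc.map_lintegral, ← SimpleFunc.lintegral_eq_lintegral]
      rfl
    rw [h1, Equiv.sum_comp e (fun c : R => F c * μ (φ ⁻¹' {(c : ℝ≥0∞)})),
      Finset.sum_coe_sort R (fun c => F c * μ (φ ⁻¹' {c})), hR, Finset.sum_filter]
    refine Finset.sum_congr rfl fun c _ => ?_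
    split_ifs with h
    · rfl
    · rw [not_not] at h
      simp [h, hF]

lemma tendsto_lintegral_expNeg {E : Type*} [MeasurableSpace E] {μ : Measure E} [IsFiniteMeasure μ]
    {u : ℕ → E → ℝ≥0∞} {v : E → ℝ≥0∞} (hu : ∀ n, Measurable (u n))
    (h : ∀ x, Tendsto (fun n => u n x) atTop (𝓝 (v x))) :
    Tendsto (fun n => ∫⁻ x, expNeg (u n x) ∂μ) atTop (𝓝 (∫⁻ x, expNeg (v x) ∂μ)) :=
  tendsto_lintegral_of_dominated_convergence (fun _ => 1)
    (fun n => measurable_expNeg.comp (hu n)) (fun n => ae_of_all _ fun x => expNeg_le_one _)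
    (by simp) (ae_of_all _ fun x => (continuous_expNeg.tendsto _).comp (h x))

/-- The measure may be infinite, so no constant dominates; monotone convergence is used instead. -/
lemma tendsto_lintegral_one_sub_expNeg {E : Type*} [MeasurableSpace E] (μ : Measure E)
    {u : ℕ → E → ℝ≥0∞} {v : E → ℝ≥0∞} (hu : ∀ n, Measurable (u n)) (hmono : Monotone u)
    (h : ∀ x, Tendsto (fun n => u n x) atTop (𝓝 (v x))) :
    Tendsto (fun n => ∫⁻ x, (1 - expNeg (u n x)) ∂μ) atTop
      (𝓝 (∫⁻ x, (1 - expNeg (v x)) ∂μ)) := by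
  refine lintegral_tendsto_of_tendsto_of_monotone
    (fun n => (measurable_const.sub (measurable_expNeg.comp (hu n))).aemeasurable)
    (ae_of_all _ fun x n n' hn => tsub_le_tsub_left (antitone_expNeg (hmono hn x)) _)
    (ae_of_all _ fun x => ?_)
  exact ENNReal.Tendsto.sub tendsto_const_nhds ((continuous_expNeg.tendsto _).comp (h x))
    (Or.inl ENNReal.one_ne_top)

section

variable {Ω : Type*} [MeasurableSpace Ω] {P : Measure Ω}

lemma measurable_lintegral_comp {Φ : Ω → Measure Plane} (hΦ : Measurable Φ)
    {w : Plane → ℝ≥0∞} (hw : Measurable w) : Measurable fun ω => ∫⁻ x, w x ∂Φ ω :=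
  (Measure.measurable_lintegral hw).comp hΦ

/-- Counts on the disjoint level sets are independent, so the expectation factors into Poisson
Laplace transforms. `hφ` is there because the law of a count is prescribed only on sets of finite
intensity. -/
lemma IsPoissonProcess.lintegral_expNeg_simpleFunc {Φ : Ω → Measure Plane} {Λ : Measure Plane}
    (h : IsPoissonProcess P Φ Λ) (hΦ : Measurable Φ) (φ : SimpleFunc Plane ℝ≥0∞)
    (hφ : ∀ c, c ≠ 0 → Λ (φ ⁻¹' {c}) < ∞) :
    ∫⁻ ω, expNeg (∫⁻ x, φ x ∂Φ ω) ∂P = expNeg (∫⁻ x, (1 - expNeg (φ x)) ∂Λ) := by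
  obtain ⟨m, c, hc, hdisj, hsum⟩ := φ.exists_lintegral_comp_eq_sum
  have hB : ∀ l, MeasurableSet (φ ⁻¹' {c l}) := fun l => φ.measurableSet_preimage _
  have hmeas : ∀ l, Measurable fun z : ℝ≥0∞ => expNeg (c l * z) := fun l =>
    measurable_expNeg.comp (measurable_const.mul measurable_id)
  rw [hsum (fun z => 1 - expNeg z) (by simp), expNeg_sum]
  have hΦs : ∀ ω, ∫⁻ x, φ x ∂Φ ω = ∑ l, c l * Φ ω (φ ⁻¹' {c l}) := fun ω => hsum id rfl (Φ ω)
  simp_rw [hΦs, expNeg_sum]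
  have hind := (h.indep_counts m _ hB hdisj).comp _ hmeas
  have := lintegral_prod_eq_prod_lintegral_of_indepFun Finset.univ _ hind
    (fun l => (hmeas l).comp ((Measure.measurable_coe (hB l)).comp hΦ))
  simp only [Function.comp_def] at this
  rw [this]
  refine Finset.prod_congr rfl fun l _ => ?_
  have hlaw := h.hasLaw_count _ (hB l) (hφ _ (hc l))
  rw [← ENNReal.coe_toNNReal (hφ _ (hc l)).ne, ← lintegral_expNeg_poissonMeasure,
    hlaw.lintegral_comp (hmeas l).aemeasurable, lintegral_map (hmeas l) (by fun_prop)]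

/-- The Laplace functional of a Poisson process. -/
theorem IsPoissonProcess.lintegral_expNeg {Φ : Ω → Measure Plane} {Λ : Measure Plane}
    [SigmaFinite Λ] [IsFiniteMeasure P]
    (h : IsPoissonProcess P Φ Λ) (hΦ : Measurable Φ) {w : Plane → ℝ≥0∞} (hw : Measurable w) :
    ∫⁻ ω, expNeg (∫⁻ x, w x ∂Φ ω) ∂P = expNeg (∫⁻ x, (1 - expNeg (w x)) ∂Λ) := by
  -- Restricting to the spanning sets gives the nonzero level sets finite `Λ`-measure and keeps the
  -- sequence increasing.
  let φ : ℕ → SimpleFunc Plane ℝ≥0∞ := fun n => (SimpleFunc.eapprox w n).restrict (spanningSets Λ n)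
  have hS := measurableSet_spanningSets Λ
  have hφ : ∀ n, ⇑(φ n) = (spanningSets Λ n).indicator (SimpleFunc.eapprox w n) := fun n =>
    SimpleFunc.coe_restrict _ (hS n)
  have hmono : Monotone fun n => ⇑(φ n) := by
    intro n n' hn x
    simp only [hφ]
    refine (indicator_le_indicator (SimpleFunc.monotone_eapprox w hn x)).trans ?_
    exact indicator_le_indicator_of_subset (monotone_spanningSets Λ hn) (fun _ => zero_le) x
  have hlim : ∀ x, Tendsto (fun n => φ n x) atTop (𝓝 (w x)) := by
    intro x
    have h1 : Tendsto (fun n => SimpleFunc.eapprox w n x) atTop (𝓝 (w x)) := by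
      rw [← SimpleFunc.iSup_eapprox_apply hw x]
      exact tendsto_atTop_iSup fun n n' hn => SimpleFunc.monotone_eapprox w hn x
    refine h1.congr' ?_
    filter_upwards [eventually_ge_atTop (spanningSetsIndex Λ x)] with n hn
    rw [hφ, indicator_of_mem]
    exact monotone_spanningSets Λ hn (mem_spanningSetsIndex Λ x)
  have hfin : ∀ n c, c ≠ 0 → Λ (φ n ⁻¹' {c}) < ∞ := by
    intro n c hc
    refine (measure_mono fun x hx => ?_).trans_lt (measure_spanningSets_lt_top Λ n)
    by_contra hxn
    rw [mem_preimage, hφ, indicator_of_notMem hxn] at hx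
    exact hc hx.symm
  have hm : ∀ n, Measurable (φ n) := fun n => (φ n).measurable
  have hL : ∀ μ : Measure Plane, Tendsto (fun n => ∫⁻ x, φ n x ∂μ) atTop (𝓝 (∫⁻ x, w x ∂μ)) :=
    fun μ => lintegral_tendsto_of_tendsto_of_monotone (fun n => (hm n).aemeasurable)
      (ae_of_all _ fun x n n' hn => hmono hn x) (ae_of_all _ hlim)
  have h1 := tendsto_lintegral_expNeg (μ := P)
    (fun n => measurable_lintegral_comp hΦ (hm n)) (fun ω => hL (Φ ω))
  have h2 := (continuous_expNeg.tendsto _).comp (tendsto_lintegral_one_sub_expNeg Λ hm hmono hlim)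
  refine tendsto_nhds_unique h1 (h2.congr fun n => ?_)
  exact (h.lintegral_expNeg_simpleFunc hΦ (φ n) (hfin n)).symm

end

/-! ### Laplace functional of conditionally independent Poisson processes -/

lemma lintegral_expNeg_pi_poissonMeasure {κ : Type*} [Fintype κ] (c : κ → ℝ≥0∞) (r : κ → ℝ≥0) :
    ∫⁻ k : κ → ℕ, expNeg (∑ q, c q * k q) ∂Measure.pi (fun q => poissonMeasure (r q)) =
      expNeg (∑ q, (1 - expNeg (c q)) * r q) := by
  simp_rw [expNeg_sum, ← lintegral_expNeg_poissonMeasure]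
  have hind : iIndepFun (fun (q : κ) (k : κ → ℕ) => expNeg (c q * k q))
      (Measure.pi fun q => poissonMeasure (r q)) :=
    iIndepFun_pi (X := fun q (n : ℕ) => expNeg (c q * n)) fun q => by fun_prop
  rw [lintegral_prod_eq_prod_lintegral_of_indepFun _ _ hind (fun q => .of_discrete)]
  refine Finset.prod_congr rfl fun q _ => ?_
  exact (measurePreserving_eval (fun q => poissonMeasure (r q)) q).lintegral_comp
    (f := fun n : ℕ => expNeg (c q * n)) (by fun_prop)

section

variable {Ω : Type*} {𝓖 : MeasurableSpace Ω} [mΩ : MeasurableSpace Ω] {P : Measure Ω} [IsProbabilityMeasure P] {ι : Type*}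

/-- Integrating the conditional probability removes the conditioning. The intensities are not
assumed measurable here: measurability of the Poisson product comes from its a.e. equality with a
conditional expectation. -/
lemma IsCondIndepPoisson.measure_counts_eq (h𝓖 : 𝓖 ≤ mΩ)
    {Φ Λ : ι → Ω → Measure Plane} (h : IsCondIndepPoisson P 𝓖 Φ Λ) (hΦ : ∀ i, Measurable (Φ i))
    (S : Finset ι) {m : ℕ} {B : Fin m → Set Plane} (hB : ∀ l, MeasurableSet (B l))
    (hdisj : Pairwise fun l l' => Disjoint (B l) (B l')) (k : S × Fin m → ℕ) :
    AEMeasurable (fun ω => Measure.pi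
      (fun q : S × Fin m => poissonMeasure (Λ q.1 ω (B q.2)).toNNReal) {k}) P ∧
    P {ω | ∀ q : S × Fin m, Φ q.1 ω (B q.2) = k q} =
      ∫⁻ ω, Measure.pi (fun q : S × Fin m => poissonMeasure (Λ q.1 ω (B q.2)).toNNReal) {k} ∂P := by
  classical
  let k' : ι → Fin m → ℕ := fun i l => if hi : i ∈ S then k (⟨i, hi⟩, l) else 0
  set A : Set Ω := {ω | ∀ i ∈ S, ∀ l, Φ i ω (B l) = (k' i l : ℝ≥0∞)} with hA
  have hAk : {ω | ∀ q : S × Fin m, Φ q.1 ω (B q.2) = k q} = A := by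
    ext ω
    simp only [mem_ofPred_eq, hA, Prod.forall, Subtype.forall]
    refine forall₃_congr fun i hi l => ?_
    simp [k', hi]
  have hAm : MeasurableSet A := by
    rw [← hAk, ofPred_forall]
    exact MeasurableSet.iInter fun q =>
      (Measure.measurable_coe (hB q.2)).comp (hΦ q.1) (measurableSet_singleton _)
  have hcond := h S m B hB hdisj k'
  have hpi : ∀ ω, Measure.pi (fun q : S × Fin m => poissonMeasure (Λ q.1 ω (B q.2)).toNNReal) {k} =
      ENNReal.ofReal
        (∏ i ∈ S, ∏ l, (poissonMeasure (Λ i ω (B l)).toNNReal).real {k' i l}) := by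
    intro ω
    rw [Measure.pi_singleton, Fintype.prod_prod_type,
      ← Finset.prod_coe_sort S (fun i => ∏ l, (poissonMeasure (Λ i ω (B l)).toNNReal).real {k' i l}),
      ENNReal.ofReal_prod_of_nonneg (fun i _ => Finset.prod_nonneg fun l _ => measureReal_nonneg)]
    refine Finset.prod_congr rfl fun i _ => ?_
    rw [ENNReal.ofReal_prod_of_nonneg (fun l _ => measureReal_nonneg)]
    refine Finset.prod_congr rfl fun l _ => ?_
    simp [k']
  have hint := integrable_condExp.congr hcond
  simp_rw [hpi, hAk]
  refine ⟨hint.aemeasurable.ennreal_ofReal, ?_⟩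
  rw [← ofReal_integral_eq_lintegral_ofReal hint
    (ae_of_all _ fun ω => Finset.prod_nonneg fun i _ => Finset.prod_nonneg fun l _ =>
      measureReal_nonneg), ← integral_congr_ae hcond, integral_condExp h𝓖]
  change _ = ENNReal.ofReal (∫ ω, A.indicator (fun _ => (1 : ℝ)) ω ∂P)
  rw [integral_indicator_const _ hAm]
  simp

/-- Both sides expand into sums over vectors `k` of counts on the level sets, and agree term by term
by `measure_counts_eq`. Integrality of the counts ensures that these vectors exhaust all outcomes.
-/
lemma IsCondIndepPoisson.lintegral_expNeg_simpleFunc (h𝓖 : 𝓖 ≤ mΩ)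
    {Φ Λ : ι → Ω → Measure Plane} (h : IsCondIndepPoisson P 𝓖 Φ Λ) (hΦ : ∀ i, Measurable (Φ i))
    (hΦn : ∀ i ω B, MeasurableSet B → ∃ n : ℕ, Φ i ω B = n) (hΛ : ∀ i ω, IsFiniteMeasure (Λ i ω))
    (S : Finset ι) (φ : SimpleFunc Plane ℝ≥0∞) :
    ∫⁻ ω, expNeg (∑ i ∈ S, ∫⁻ x, φ x ∂Φ i ω) ∂P =
      ∫⁻ ω, expNeg (∑ i ∈ S, ∫⁻ x, (1 - expNeg (φ x)) ∂Λ i ω) ∂P := by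
  classical
  obtain ⟨m, c, -, hdisj, hsum⟩ := φ.exists_lintegral_comp_eq_sum
  set B : Fin m → Set Plane := fun l => φ ⁻¹' {c l}
  have hB : ∀ l, MeasurableSet (B l) := fun l => φ.measurableSet_preimage _
  choose Z hZ using fun (q : S × Fin m) ω => hΦn q.1 ω (B q.2) (hB q.2)
  have hZm : Measurable fun ω q => Z q ω := by
    refine measurable_pi_lambda _ fun q => measurable_to_countable' fun n => ?_
    have : Z q ⁻¹' {n} = (fun ω => Φ q.1 ω (B q.2)) ⁻¹' {(n : ℝ≥0∞)} := by
      ext ω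
      simp [hZ]
    rw [this]
    exact (Measure.measurable_coe (hB q.2)).comp (hΦ q.1) (measurableSet_singleton _)
  have hΦs : ∀ ω, ∑ i ∈ S, ∫⁻ x, φ x ∂Φ i ω = ∑ q : S × Fin m, c q.2 * Z q ω := by
    intro ω
    rw [Fintype.sum_prod_type, ← Finset.sum_coe_sort]
    refine Finset.sum_congr rfl fun i _ => (hsum id rfl (Φ i ω)).trans ?_
    exact Finset.sum_congr rfl fun l _ => by rw [← hZ (i, l) ω]; rfl
  have hΛs : ∀ ω, ∑ i ∈ S, ∫⁻ x, (1 - expNeg (φ x)) ∂Λ i ω =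
      ∑ q : S × Fin m, (1 - expNeg (c q.2)) * (Λ q.1 ω (B q.2)).toNNReal := by
    intro ω
    rw [Fintype.sum_prod_type, ← Finset.sum_coe_sort]
    refine Finset.sum_congr rfl fun i _ => (hsum (fun z => 1 - expNeg z) (by simp) (Λ i ω)).trans ?_
    exact Finset.sum_congr rfl fun l _ => by rw [ENNReal.coe_toNNReal (measure_ne_top _ _)]
  simp_rw [hΦs, hΛs, ← lintegral_expNeg_pi_poissonMeasure, lintegral_countable']
  have hk := fun k => h.measure_counts_eq h𝓖 hΦ S hB hdisj k
  rw [lintegral_tsum fun k => (hk k).1.const_mul _,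
    ← lintegral_map (f := fun k : S × Fin m → ℕ => expNeg (∑ q, c q.2 * k q)) .of_discrete hZm,
    lintegral_countable']
  refine tsum_congr fun k => ?_
  rw [lintegral_const_mul'' _ (hk k).1, ← (hk k).2, Measure.map_apply hZm (measurableSet_singleton _)]
  congr 2
  ext ω
  simp [hZ, funext_iff]

/-- The joint Laplace functional of countably many point processes which are conditionally
independent and Poisson. -/
theorem IsCondIndepPoisson.lintegral_expNeg (h𝓖 : 𝓖 ≤ mΩ)
    {Φ Λ : ℕ → Ω → Measure Plane} (h : IsCondIndepPoisson P 𝓖 Φ Λ) (hΦ : ∀ i, Measurable (Φ i))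
    (hΦn : ∀ i ω B, MeasurableSet B → ∃ n : ℕ, Φ i ω B = n) (hΛ : ∀ i ω, IsFiniteMeasure (Λ i ω))
    (hΛm : ∀ i, Measurable (Λ i)) {v : Plane → ℝ≥0∞} (hv : Measurable v) :
    ∫⁻ ω, expNeg (∑' i, ∫⁻ x, v x ∂Φ i ω) ∂P =
      ∫⁻ ω, expNeg (∑' i, ∫⁻ x, (1 - expNeg (v x)) ∂Λ i ω) ∂P := by
  have hqm : ∀ {u : Plane → ℝ≥0∞}, Measurable u → Measurable fun x => 1 - expNeg (u x) :=
    fun hu => measurable_const.sub (measurable_expNeg.comp hu)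
  -- Two limits: simple functions increase to `v` for a fixed finite set of clusters, then the
  -- finite set grows.
  have hfin : ∀ S : Finset ℕ, ∫⁻ ω, expNeg (∑ i ∈ S, ∫⁻ x, v x ∂Φ i ω) ∂P =
      ∫⁻ ω, expNeg (∑ i ∈ S, ∫⁻ x, (1 - expNeg (v x)) ∂Λ i ω) ∂P := by
    intro S
    let φ := SimpleFunc.eapprox v
    have hm : ∀ n, Measurable (φ n) := fun n => (φ n).measurable
    have hmono : Monotone fun n => ⇑(φ n) := fun n n' hn x => SimpleFunc.monotone_eapprox v hn x
    have hlim : ∀ x, Tendsto (fun n => φ n x) atTop (𝓝 (v x)) := by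
      intro x
      rw [← SimpleFunc.iSup_eapprox_apply hv x]
      exact tendsto_atTop_iSup fun n n' hn => hmono hn x
    have h1 := tendsto_lintegral_expNeg (μ := P)
      (u := fun n ω => ∑ i ∈ S, ∫⁻ x, φ n x ∂Φ i ω)
      (fun n => Finset.measurable_fun_sum _ fun i _ => measurable_lintegral_comp (hΦ i) (hm n))
      (fun ω => tendsto_finsetSum _ fun i _ =>
        lintegral_tendsto_of_tendsto_of_monotone (fun n => (hm n).aemeasurable)
          (ae_of_all _ fun x n n' hn => hmono hn x) (ae_of_all _ hlim))
    have h2 := tendsto_lintegral_expNeg (μ := P)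
      (u := fun n ω => ∑ i ∈ S, ∫⁻ x, (1 - expNeg (φ n x)) ∂Λ i ω)
      (fun n => Finset.measurable_fun_sum _ fun i _ =>
        measurable_lintegral_comp (hΛm i) (hqm (hm n)))
      (fun ω => tendsto_finsetSum _ fun i _ =>
        tendsto_lintegral_one_sub_expNeg (Λ i ω) hm hmono hlim)
    refine tendsto_nhds_unique h1 (h2.congr fun n => ?_)
    exact (h.lintegral_expNeg_simpleFunc h𝓖 hΦ hΦn hΛ S (φ n)).symm
  have h1 := tendsto_lintegral_expNeg (μ := P)
    (u := fun n ω => ∑ i ∈ Finset.range n, ∫⁻ x, v x ∂Φ i ω)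
    (fun n => Finset.measurable_fun_sum _ fun i _ => measurable_lintegral_comp (hΦ i) hv)
    (fun ω => ENNReal.tendsto_nat_tsum _)
  have h2 := tendsto_lintegral_expNeg (μ := P)
    (u := fun n ω => ∑ i ∈ Finset.range n, ∫⁻ x, (1 - expNeg (v x)) ∂Λ i ω)
    (fun n => Finset.measurable_fun_sum _ fun i _ => measurable_lintegral_comp (hΛm i) (hqm hv))
    (fun ω => ENNReal.tendsto_nat_tsum _)
  exact tendsto_nhds_unique h1 (h2.congr fun n => (hfin _).symm)

end

/-! ### Averaging over the fading -/

/-- The Laplace transform of the exponential distribution, with an argument in `[0, ∞]`. -/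
lemma lintegral_expNeg_expMeasure (k : ℝ≥0∞) :
    ∫⁻ x, expNeg (ENNReal.ofReal x * k) ∂expMeasure 1 = (1 + k)⁻¹ := by
  have hm : Measurable fun x : ℝ => expNeg (ENNReal.ofReal x * k) := by fun_prop
  have hpm : ∀ r, Measurable (exponentialPDF r) := fun r =>
    (measurable_exponentialPDFReal r).ennreal_ofReal
  rw [show expMeasure 1 = volume.withDensity (exponentialPDF 1) from rfl,
    lintegral_withDensity_eq_lintegral_mul _ (hpm 1) hm]
  rcases eq_or_ne k ∞ with rfl | hk
  -- For `k = ∞` the integrand vanishes except at the null point `x = 0`, where `0 * ∞ = 0`.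
  · simp only [add_top, ENNReal.inv_top]
    rw [lintegral_eq_zero_iff ((hpm 1).mul hm)]
    filter_upwards [Measure.ae_ne volume (0 : ℝ)] with x hx
    rcases lt_or_gt_of_ne hx with h | h
    · simp [exponentialPDF_of_neg h]
    · simp [ENNReal.mul_top, h]
  · set c := k.toReal with hc
    have hc0 : 0 ≤ c := ENNReal.toReal_nonneg
    have hk' : k = ENNReal.ofReal c := (ENNReal.ofReal_toReal hk).symm
    have h1 : (1 : ℝ≥0∞) + k = ENNReal.ofReal (1 + c) := by
      rw [hk', ENNReal.ofReal_add zero_le_one hc0, ENNReal.ofReal_one]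
    -- Exponential tilting: the product is a multiple of the density of rate `1 + c`, whose total
    -- mass is one.
    have hpdf : ∀ x, (exponentialPDF 1 * fun x => expNeg (ENNReal.ofReal x * k)) x =
        (1 + k)⁻¹ * exponentialPDF (1 + c) x := by
      intro x
      rcases lt_or_ge x 0 with hx | hx
      · simp [exponentialPDF_of_neg hx]
      · rw [Pi.mul_apply, exponentialPDF_of_nonneg hx, exponentialPDF_of_nonneg hx, h1, hk',
          ← ENNReal.ofReal_mul hx, expNeg_ofReal (mul_nonneg hx hc0),
          ← ENNReal.ofReal_mul (by positivity), ← ENNReal.ofReal_inv_of_pos (by positivity),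
          ← ENNReal.ofReal_mul (by positivity), inv_mul_cancel_left₀ (by positivity), one_mul,
          ← Real.exp_add]
        ring_nf
    simp_rw [hpdf]
    rw [lintegral_const_mul _ (hpm _),
      lintegral_exponentialPDF_eq_one (by positivity), mul_one]

/-- The random number of terms takes countably many values, so measurability can be checked for each
fixed value. -/
lemma Measurable.sum_range_comp {Z : Type*} [MeasurableSpace Z] {M : Z → ℕ}
    (hM : Measurable M) {g : ℕ → Z → ℝ≥0∞} (hg : ∀ j, Measurable (g j)) :
    Measurable fun z => ∑ j ∈ Finset.range (M z), g j z := by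
  have : Measurable fun p : ℕ × Z => ∑ j ∈ Finset.range p.1, g j p.2 :=
    measurable_from_prod_countable_right fun n =>
      Finset.measurable_fun_sum (Finset.range n) fun j _ => hg j
  exact this.comp (hM.prodMk measurable_id)

/-- The function `v` with `exp (-v y) = 𝔼 exp (-s h ‖y‖ ^ (-α))` for a standard exponential
variable `h`. -/
def fadingExponent (α : ℝ) (s : ℝ≥0∞) (y : Plane) : ℝ≥0∞ :=
  (ENNReal.log (1 + s * ‖y‖ₑ ^ (-α))).toENNReal

lemma measurable_fadingExponent (α : ℝ) (s : ℝ≥0∞) : Measurable (fadingExponent α s) := by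
  have : Measurable fun y : Plane => 1 + s * ‖y‖ₑ ^ (-α) := by fun_prop
  exact measurable_ereal_toENNReal.comp this.ennreal_log

lemma expNeg_fadingExponent (α : ℝ) (s : ℝ≥0∞) (y : Plane) :
    expNeg (fadingExponent α s y) = (1 + s * ‖y‖ₑ ^ (-α))⁻¹ :=
  expNeg_toENNReal_log le_self_add

section

variable {Ω : Type*}

lemma lintegral_offspringProcess (N : ℕ → Ω → ℕ) (Y : ℕ → ℕ → Ω → Plane) (i : ℕ) (ω : Ω)
    {v : Plane → ℝ≥0∞} (hv : Measurable v) :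
    ∫⁻ y, v y ∂(offspringProcess N Y i ω) = ∑ j ∈ Finset.range (N i ω), v (Y i j ω) := by
  simp [offspringProcess, lintegral_finsetSum_measure, lintegral_dirac' _ hv]

lemma offspringProcess_apply (N : ℕ → Ω → ℕ) (Y : ℕ → ℕ → Ω → Plane) (i : ℕ) (ω : Ω)
    {B : Set Plane} (hB : MeasurableSet B) :
    offspringProcess N Y i ω B = ∑ j ∈ Finset.range (N i ω), B.indicator 1 (Y i j ω) := by
  simp [offspringProcess, Measure.dirac_apply' _ hB]

lemma exists_offspringProcess_eq_natCast (N : ℕ → Ω → ℕ) (Y : ℕ → ℕ → Ω → Plane) (i : ℕ) (ω : Ω)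
    {B : Set Plane} (hB : MeasurableSet B) : ∃ n : ℕ, offspringProcess N Y i ω B = n := by
  classical
  refine ⟨∑ j ∈ Finset.range (N i ω), if Y i j ω ∈ B then 1 else 0, ?_⟩
  rw [offspringProcess_apply N Y i ω hB]
  push_cast
  rfl

end

section

variable {Ω : Type*} [MeasurableSpace Ω] {P : Measure Ω}

lemma lintegral_expNeg_sum_gains {h : ℕ → ℕ → Ω → ℝ}
    (hm : ∀ i j, Measurable (h i j)) (hlaw : ∀ i j, HasLaw (h i j) (expMeasure 1) P)
    (hind : iIndepFun (fun (q : ℕ × ℕ) ω => h q.1 q.2 ω) P) (n : ℕ) (M : ℕ → ℕ)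
    (k : ℕ → ℕ → ℝ≥0∞) :
    ∫⁻ ω, expNeg (∑ i ∈ Finset.range n, ∑ j ∈ Finset.range (M i),
      ENNReal.ofReal (h i j ω) * k i j) ∂P =
    ∏ i ∈ Finset.range n, ∏ j ∈ Finset.range (M i), (1 + k i j)⁻¹ := by
  let T : Finset (ℕ × ℕ) := ((Finset.range n).sigma fun i => Finset.range (M i)).map
    (Equiv.sigmaEquivProd ℕ ℕ).toEmbedding
  have hT : ∀ p : ℕ × ℕ, p ∈ T ↔ p.1 ∈ Finset.range n ∧ p.2 ∈ Finset.range (M p.1) := by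
    rintro ⟨i, j⟩
    simp [T]
  have hg : ∀ q : ℕ × ℕ, Measurable fun x : ℝ => expNeg (ENNReal.ofReal x * k q.1 q.2) :=
    fun q => by fun_prop
  have := lintegral_prod_eq_prod_lintegral_of_indepFun T _ (hind.comp _ hg)
    fun q => (hg q).comp (hm q.1 q.2)
  simp only [Function.comp_def] at this
  have hsum : ∀ ω, ∑ i ∈ Finset.range n, ∑ j ∈ Finset.range (M i),
      ENNReal.ofReal (h i j ω) * k i j = ∑ q ∈ T, ENNReal.ofReal (h q.1 q.2 ω) * k q.1 q.2 :=
    fun ω => (Finset.sum_finset_product T _ _ hT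
      (f := fun q => ENNReal.ofReal (h q.1 q.2 ω) * k q.1 q.2)).symm
  simp_rw [hsum, expNeg_sum]
  rw [this, Finset.prod_finset_product T (Finset.range n) (fun i => Finset.range (M i)) hT]
  refine Finset.prod_congr rfl fun i _ => Finset.prod_congr rfl fun j _ => ?_
  rw [(hlaw i j).lintegral_comp (hg (i, j)).aemeasurable, lintegral_expNeg_expMeasure]

variable [IsProbabilityMeasure P] {X : ℕ → Ω → Plane} {N : ℕ → Ω → ℕ} {Y : ℕ → ℕ → Ω → Plane} {h : ℕ → ℕ → Ω → ℝ}

lemma measurable_offspringProcess (hN : ∀ i, Measurable (N i)) (hY : ∀ i j, Measurable (Y i j))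
    (i : ℕ) : Measurable (offspringProcess N Y i) := by
  refine Measure.measurable_of_measurable_coe _ fun B hB => ?_
  simp_rw [fun ω => offspringProcess_apply N Y i ω hB]
  exact (hN i).sum_range_comp fun j => (measurable_one.indicator hB).comp (hY i j)

lemma measurable_interCluster (α : ℝ) (hN : ∀ i, Measurable (N i))
    (hY : ∀ i j, Measurable (Y i j)) (hh : ∀ i j, Measurable (h i j)) :
    Measurable (interCluster α N Y h) := by
  refine Measurable.tsum fun i => (hN i).sum_range_comp fun j => ?_
  have h1 := hY i j
  have h2 := hh i j
  fun_prop

/-- Averaging over the fading turns the Laplace transform of the interference into a Laplace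
functional of the offspring processes. -/
theorem IsRayleighFading.lintegral_expNeg_interCluster (hh : IsRayleighFading P X N Y h)
    (hX : ∀ i, Measurable (X i)) (hN : ∀ i, Measurable (N i)) (hY : ∀ i j, Measurable (Y i j))
    (α : ℝ) (s : ℝ≥0∞) :
    ∫⁻ ω, expNeg (s * interCluster α N Y h ω) ∂P =
      ∫⁻ ω, expNeg (∑' i, ∫⁻ y, fadingExponent α s y ∂(offspringProcess N Y i ω)) ∂P := by
  have hfin : ∀ n, ∫⁻ ω, expNeg (∑ i ∈ Finset.range n, ∑ j ∈ Finset.range (N i ω),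
      ENNReal.ofReal (h i j ω) * (s * ‖Y i j ω‖ₑ ^ (-α))) ∂P =
      ∫⁻ ω, expNeg (∑ i ∈ Finset.range n,
        ∫⁻ y, fadingExponent α s y ∂(offspringProcess N Y i ω)) ∂P := by
    intro n
    -- Gains `G` and locations `L` are independent, so their joint law is a product and the gains
    -- can be integrated out with the locations frozen.
    let G : Ω → ℕ × ℕ → ℝ := fun ω q => h q.1 q.2 ω
    let L : Ω → (ℕ → Plane) × (ℕ → ℕ) × (ℕ × ℕ → Plane) :=
      fun ω => ((fun i => X i ω), (fun i => N i ω), (fun q => Y q.1 q.2 ω))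
    let F : (ℕ × ℕ → ℝ) × ((ℕ → Plane) × (ℕ → ℕ) × (ℕ × ℕ → Plane)) → ℝ≥0∞ := fun p =>
      expNeg (∑ i ∈ Finset.range n, ∑ j ∈ Finset.range (p.2.2.1 i),
        ENNReal.ofReal (p.1 (i, j)) * (s * ‖p.2.2.2 (i, j)‖ₑ ^ (-α)))
    have hG : Measurable G := measurable_pi_lambda _ fun q => hh.measurable_gain q.1 q.2
    have hL : Measurable L := (measurable_pi_lambda _ hX).prodMk
      ((measurable_pi_lambda _ hN).prodMk (measurable_pi_lambda _ fun q => hY q.1 q.2))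
    have hF : Measurable F := by
      refine measurable_expNeg.comp (Finset.measurable_fun_sum _ fun i _ => ?_)
      refine Measurable.sum_range_comp (by fun_prop) fun j => by fun_prop
    have hlaw := (indepFun_iff_map_prod_eq_prod_map_map hG.aemeasurable hL.aemeasurable).1
      hh.indep_locations
    calc _ = ∫⁻ ω, F (G ω, L ω) ∂P := rfl
      _ = ∫⁻ ω, ∫⁻ ω', F (G ω', L ω) ∂P ∂P := by
          rw [← lintegral_map (f := F) hF (hG.prodMk hL), hlaw, lintegral_prod_symm' _ hF,
            lintegral_map hF.lintegral_prod_left' hL]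
          refine lintegral_congr fun ω => ?_
          exact lintegral_map (hF.comp measurable_prodMk_right) hG
      _ = _ := by
          refine lintegral_congr fun ω => ?_
          refine (lintegral_expNeg_sum_gains hh.measurable_gain hh.hasLaw_gain hh.indep_gains n
            (fun i => N i ω) fun i j => s * ‖Y i j ω‖ₑ ^ (-α)).trans ?_
          simp_rw [lintegral_offspringProcess N Y _ ω (measurable_fadingExponent α s), expNeg_sum,
            expNeg_fadingExponent]
  have h1 := tendsto_lintegral_expNeg (μ := P)
    (u := fun n ω => ∑ i ∈ Finset.range n, ∑ j ∈ Finset.range (N i ω),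
      ENNReal.ofReal (h i j ω) * (s * ‖Y i j ω‖ₑ ^ (-α)))
    (fun n => Finset.measurable_fun_sum _ fun i _ => (hN i).sum_range_comp fun j => by
      have h1 := hY i j
      have h2 := hh.measurable_gain i j
      fun_prop)
    (fun ω => ENNReal.tendsto_nat_tsum _)
  have h2 := tendsto_lintegral_expNeg (μ := P)
    (u := fun n ω => ∑ i ∈ Finset.range n,
      ∫⁻ y, fadingExponent α s y ∂(offspringProcess N Y i ω))
    (fun n => Finset.measurable_fun_sum _ fun i _ =>
      measurable_lintegral_comp (measurable_offspringProcess hN hY i)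
        (measurable_fadingExponent α s))
    (fun ω => ENNReal.tendsto_nat_tsum _)
  refine (lintegral_congr fun ω => ?_).trans
    (tendsto_nhds_unique h1 (h2.congr fun n => (hfin n).symm))
  rw [interCluster, ← ENNReal.tsum_mul_left]
  simp_rw [Finset.mul_sum, mul_left_comm s]

/-! ### The Laplace transform as an integral over parent locations -/

lemma measurable_restrict_closedBall (c : ℝ≥0∞) (D : ℝ) :
    Measurable fun x : Plane => c • (volume.restrict (Metric.closedBall x D) : Measure Plane) := by
  refine Measure.measurable_of_measurable_coe _ fun B hB => ?_
  have hS : MeasurableSet {p : Plane × Plane | p.2 ∈ B ∧ dist p.2 p.1 ≤ D} :=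
    (measurable_snd hB).inter (measurableSet_le (measurable_snd.dist measurable_fst) measurable_const)
  simp only [Measure.smul_apply, smul_eq_mul, Measure.restrict_apply hB]
  exact (measurable_measure_prodMk_left (ν := volume) hS).const_mul c

lemma measurable_parentProcess (hX : ∀ i, Measurable (X i)) : Measurable (parentProcess X) := by
  refine Measure.measurable_of_measurable_coe _ fun B hB => ?_
  simp only [parentProcess, Measure.sum_apply _ hB]
  exact Measurable.tsum fun i =>
    (Measure.measurable_coe hB).comp (Measure.measurable_dirac.comp (hX i))

/-- The exponent of the Laplace transform of the interference from a single cluster centred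
at `x`. -/
def clusterExponent (α lam D : ℝ) (s : ℝ≥0∞) (x : Plane) : ℝ≥0∞ :=
  ENNReal.ofReal lam * ∫⁻ y in Metric.closedBall x D, (1 - (1 + s * ‖y‖ₑ ^ (-α))⁻¹)

lemma measurable_clusterExponent (α lam D : ℝ) (s : ℝ≥0∞) :
    Measurable (clusterExponent α lam D s) := by
  have hq : Measurable fun y : Plane => 1 - (1 + s * ‖y‖ₑ ^ (-α))⁻¹ := by fun_prop
  have h := measurable_lintegral_comp (measurable_restrict_closedBall 1 D) hq
  simp only [one_smul] at h
  exact h.const_mul _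

/-- The Laplace transform of the interference, in terms of `clusterExponent`. -/
theorem IsMaternClusterProcess.lintegral_expNeg_interCluster {lamP lam D : ℝ}
    (hΦ : IsMaternClusterProcess P lamP lam D X N Y) (hh : IsRayleighFading P X N Y h)
    (α : ℝ) (s : ℝ≥0∞) :
    ∫⁻ ω, expNeg (s * interCluster α N Y h ω) ∂P =
      expNeg (ENNReal.ofReal lamP * ∫⁻ x, (1 - expNeg (clusterExponent α lam D s x))) := by
  have hX := hΦ.measurable_parent
  have hv := measurable_fadingExponent α s
  have hW := measurable_clusterExponent α lam D s
  rw [hh.lintegral_expNeg_interCluster hX hΦ.measurable_num hΦ.measurable_offspring,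
    hΦ.offspring.lintegral_expNeg (measurable_pi_lambda _ hX).comap_le
      (measurable_offspringProcess hΦ.measurable_num hΦ.measurable_offspring)
      (fun i ω B hB => exists_offspringProcess_eq_natCast N Y i ω hB)
      (fun i ω => by
        have : IsFiniteMeasure (volume.restrict (Metric.closedBall (X i ω) D)) :=
          isFiniteMeasure_restrict.2 measure_closedBall_lt_top.ne
        exact Measure.smul_finite _ ENNReal.ofReal_ne_top)
      (fun i => (measurable_restrict_closedBall _ D).comp (hX i)) hv]
  have : SigmaFinite (ENNReal.ofReal lamP • (volume : Measure Plane)) :=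
    inferInstanceAs (SigmaFinite (lamP.toNNReal • (volume : Measure Plane)))
  -- The sum of the cluster exponents over the parents is an integral against the parent process, to
  -- which the Poisson formula applies.
  have hpar := hΦ.parents.lintegral_expNeg (measurable_parentProcess hX) hW
  rw [lintegral_smul_measure, smul_eq_mul] at hpar
  rw [← hpar]
  refine lintegral_congr fun ω => ?_
  rw [parentProcess, lintegral_sum_measure]
  congr 1
  refine tsum_congr fun i => ?_
  rw [lintegral_dirac' _ hW, lintegral_smul_measure, clusterExponent, smul_eq_mul]
  simp_rw [expNeg_fadingExponent]

end

/-! ### Euler's integral and analytic continuation -/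

lemma isOpen_hypergeometricDomain : IsOpen hypergeometricDomain :=
  Complex.isOpen_slitPlane.preimage (continuous_const.sub continuous_id)

/-- `1 - z t` lies on the segment from `1` to `1 - z`, and the slit plane is star-shaped about `1`.
-/
lemma one_sub_mul_ne_zero_of_mem_hypergeometricDomain {z : ℂ} (hz : z ∈ hypergeometricDomain)
    {t : ℝ} (ht : t ∈ Icc (0 : ℝ) 1) : 1 - z * t ≠ 0 := by
  have h := Complex.starConvex_one_slitPlane hz (sub_nonneg.2 ht.2) ht.1 (sub_add_cancel 1 t)
  refine Complex.slitPlane_ne_zero ?_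
  convert! h using 1
  simp only [Complex.real_smul]
  push_cast
  ring

/-- Euler's integral for `₂F₁(1, 2/α; 1 + 2/α; z)`. -/
def eulerIntegral (α : ℝ) (z : ℂ) : ℂ :=
  ∫ t in (0 : ℝ)..1, 2 * (t : ℂ) / (1 - z * (t ^ α : ℝ))

lemma rpow_mem_Icc {α : ℝ} (hα : 0 < α) {t : ℝ} (ht : t ∈ Icc (0 : ℝ) 1) :
    t ^ α ∈ Icc (0 : ℝ) 1 :=
  ⟨Real.rpow_nonneg ht.1 _, Real.rpow_le_one ht.1 ht.2 hα.le⟩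

lemma differentiableOn_eulerIntegral {α : ℝ} (hα : 0 < α) :
    DifferentiableOn ℂ (eulerIntegral α) hypergeometricDomain := by
  intro z₀ hz₀
  obtain ⟨ε, hε, hball⟩ := Metric.nhds_basis_closedBall.mem_iff.1
    (isOpen_hypergeometricDomain.mem_nhds hz₀)
  have hcr : Continuous fun t : ℝ => t ^ α := Real.continuous_rpow_const hα.le
  have hne : ∀ z ∈ Metric.closedBall z₀ ε, ∀ t ∈ Icc (0 : ℝ) 1, 1 - z * (t ^ α : ℝ) ≠ 0 :=
    fun z hz t ht => one_sub_mul_ne_zero_of_mem_hypergeometricDomain (hball hz)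
      (rpow_mem_Icc hα ht)
  -- Compactness bounds the denominator below by some `δ > 0`, uniformly in `z` and `t`; this gives
  -- the dominating constant `2 / δ ^ 2` for the derivative.
  have hK : IsCompact (Metric.closedBall z₀ ε ×ˢ Icc (0 : ℝ) 1) :=
    (isCompact_closedBall _ _).prod isCompact_Icc
  have hc : ContinuousOn (fun p : ℂ × ℝ => ‖1 - p.1 * (p.2 ^ α : ℝ)‖)
      (Metric.closedBall z₀ ε ×ˢ Icc (0 : ℝ) 1) := by
    refine Continuous.continuousOn ?_
    exact (continuous_const.sub (continuous_fst.mul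
      (Complex.continuous_ofReal.comp (hcr.comp continuous_snd)))).norm
  obtain ⟨⟨z₁, t₁⟩, h₁, hmin⟩ := hK.exists_isMinOn
    ⟨(z₀, 0), Metric.mem_closedBall_self hε.le, by simp⟩ hc
  set δ := ‖1 - z₁ * (t₁ ^ α : ℝ)‖ with hδdef
  have hδ : 0 < δ := norm_pos_iff.2 (hne z₁ h₁.1 t₁ h₁.2)
  have hδle : ∀ z ∈ Metric.closedBall z₀ ε, ∀ t ∈ Icc (0 : ℝ) 1, δ ≤ ‖1 - z * (t ^ α : ℝ)‖ :=
    fun z hz t ht => hmin (a := (z, t)) ⟨hz, ht⟩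
  have hIoc : uIoc (0 : ℝ) 1 ⊆ Icc 0 1 := by
    rw [uIoc_of_le zero_le_one]; exact Ioc_subset_Icc_self
  have hcden : ∀ z : ℂ, Continuous fun t : ℝ => 1 - z * ((t ^ α : ℝ) : ℂ) := fun z =>
    continuous_const.sub (continuous_const.mul (Complex.continuous_ofReal.comp hcr))
  have hcont : ∀ z ∈ Metric.closedBall z₀ ε,
      ContinuousOn (fun t : ℝ => 2 * (t : ℂ) / (1 - z * (t ^ α : ℝ))) (Icc 0 1) := fun z hz =>
    (by fun_prop : Continuous fun t : ℝ => 2 * (t : ℂ)).continuousOn.div (hcden z).continuousOn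
      (hne z hz)
  have hcont' : ContinuousOn (fun t : ℝ => 2 * (t : ℂ) * (t ^ α : ℝ) / (1 - z₀ * (t ^ α : ℝ)) ^ 2)
      (Icc 0 1) :=
    ((by fun_prop : Continuous fun t : ℝ => 2 * (t : ℂ)).mul
      (Complex.continuous_ofReal.comp hcr)).continuousOn.div ((hcden z₀).pow 2).continuousOn
      fun t ht => pow_ne_zero 2 (hne z₀ (Metric.mem_closedBall_self hε.le) t ht)
  have hderiv := intervalIntegral.hasDerivAt_integral_of_dominated_loc_of_deriv_le
    (μ := volume) (a := 0) (b := 1) (𝕜 := ℂ) (s := Metric.closedBall z₀ ε) (x₀ := z₀)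
    (F := fun z (t : ℝ) => 2 * (t : ℂ) / (1 - z * (t ^ α : ℝ)))
    (F' := fun z (t : ℝ) => 2 * (t : ℂ) * (t ^ α : ℝ) / (1 - z * (t ^ α : ℝ)) ^ 2)
    (bound := fun _ => 2 / δ ^ 2)
    (Metric.closedBall_mem_nhds _ hε)
    (by
      filter_upwards [Metric.closedBall_mem_nhds z₀ hε] with z hz
      exact ((hcont z hz).mono hIoc).aestronglyMeasurable measurableSet_uIoc)
    (ContinuousOn.intervalIntegrable (by
      rw [uIcc_of_le zero_le_one]
      exact hcont z₀ (Metric.mem_closedBall_self hε.le)))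
    ((hcont'.mono hIoc).aestronglyMeasurable measurableSet_uIoc)
    (ae_of_all _ fun t ht z hz => by
      have ht' := hIoc ht
      have h2 := rpow_mem_Icc hα ht'
      rw [norm_div, norm_mul, norm_mul, norm_pow, Complex.norm_real, Complex.norm_real,
        Real.norm_of_nonneg ht'.1, Real.norm_of_nonneg h2.1, Complex.norm_ofNat]
      refine div_le_div₀ (by norm_num) ?_ (by positivity)
        (pow_le_pow_left₀ hδ.le (hδle z hz t ht') 2)
      nlinarith [ht'.1, ht'.2, h2.1, h2.2, mul_le_one₀ ht'.2 h2.1 h2.2])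
    (by simp)
    (ae_of_all _ fun t ht z hz => by
      have hd : HasDerivAt (fun z : ℂ => 1 - z * ((t ^ α : ℝ) : ℂ)) (-((t ^ α : ℝ) : ℂ)) z := by
        simpa using ((hasDerivAt_id z).mul_const ((t ^ α : ℝ) : ℂ)).const_sub 1
      convert! (hasDerivAt_const z (2 * (t : ℂ))).div hd (hne z hz t (hIoc ht)) using 1
      simp)
  exact hderiv.2.differentiableAt.differentiableWithinAt

/-- `(1)_n` cancels `n!`, and `(b)_n / (1 + b)_n` telescopes. -/
lemma hypergeometric_coefficient_eq {b : ℝ} (hb : 0 < b) (n : ℕ) :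
    ((n.factorial : ℂ)⁻¹ * (ascPochhammer ℂ n).eval 1 * (ascPochhammer ℂ n).eval (b : ℂ) *
      ((ascPochhammer ℂ n).eval ((1 + b : ℝ) : ℂ))⁻¹) = b / (n + b) := by
  have hne : (ascPochhammer ℂ n).eval ((1 + b : ℝ) : ℂ) ≠ 0 := by
    rw [Ne, ascPochhammer_eval_eq_zero_iff]
    rintro ⟨k, -, hk⟩
    have : (k : ℝ) = -(1 + b) := by exact_mod_cast hk
    have := Nat.cast_nonneg (α := ℝ) k
    linarith
  have hnb : (n + b : ℂ) ≠ 0 := by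
    have : (n + b : ℝ) ≠ 0 := by positivity
    exact_mod_cast this
  have h1 : (ascPochhammer ℂ n).eval (b : ℂ) * (b + n) =
      b * (ascPochhammer ℂ n).eval ((1 + b : ℝ) : ℂ) := by
    rw [← ascPochhammer_succ_eval, ascPochhammer_succ_left, Polynomial.eval_mul,
      Polynomial.eval_comp]
    simp [add_comm]
  have hfac : (n.factorial : ℂ) ≠ 0 := by exact_mod_cast n.factorial_ne_zero
  rw [ascPochhammer_eval_one]
  field_simp
  rw [add_comm (n : ℂ)]
  exact h1.trans (mul_comm _ _)

/-- Expand the integrand as a geometric series in `z t ^ α` and integrate termwise. -/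
lemma eulerIntegral_eq_hypergeometric {α : ℝ} (hα : 0 < α) {z : ℂ} (hz : ‖z‖ < 1) :
    eulerIntegral α z =
      ordinaryHypergeometric (1 : ℂ) ((2 / α : ℝ) : ℂ) ((1 + 2 / α : ℝ) : ℂ) z := by
  have hcr : Continuous fun t : ℝ => t ^ α := Real.continuous_rpow_const hα.le
  have hIoc : uIoc (0 : ℝ) 1 ⊆ Icc 0 1 := by
    rw [uIoc_of_le zero_le_one]; exact Ioc_subset_Icc_self
  have hnorm : ∀ t ∈ Icc (0 : ℝ) 1, ‖z * (t ^ α : ℝ)‖ ≤ ‖z‖ := fun t ht => by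
    have h2 := rpow_mem_Icc hα ht
    rw [norm_mul, Complex.norm_real, Real.norm_of_nonneg h2.1]
    exact mul_le_of_le_one_right (norm_nonneg _) h2.2
  have hsum := intervalIntegral.hasSum_integral_of_dominated_convergence (μ := volume)
    (a := 0) (b := 1) (F := fun (n : ℕ) (t : ℝ) => 2 * (t : ℂ) * (z * (t ^ α : ℝ)) ^ n)
    (f := fun t : ℝ => 2 * (t : ℂ) / (1 - z * (t ^ α : ℝ)))
    (fun n _ => 2 * ‖z‖ ^ n)
    (fun n => by
      refine Continuous.aestronglyMeasurable ?_
      exact (by fun_prop : Continuous fun t : ℝ => 2 * (t : ℂ)).mul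
        ((continuous_const.mul (Complex.continuous_ofReal.comp hcr)).pow n))
    (fun n => ae_of_all _ fun t ht => by
      have ht' := hIoc ht
      rw [norm_mul, norm_mul, norm_pow, Complex.norm_real, Real.norm_of_nonneg ht'.1,
        Complex.norm_ofNat]
      exact mul_le_mul (by linarith [ht'.2])
        (pow_le_pow_left₀ (norm_nonneg _) (hnorm t ht') n) (by positivity) (by positivity))
    (ae_of_all _ fun t _ => (summable_geometric_of_lt_one (norm_nonneg _) hz).mul_left 2)
    (by simp)
    (ae_of_all _ fun t ht =>
      (hasSum_geometric_of_norm_lt_one ((hnorm t (hIoc ht)).trans_lt hz)).mul_left _)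
  have hterm : ∀ n : ℕ, ∫ t in (0 : ℝ)..1, 2 * (t : ℂ) * (z * (t ^ α : ℝ)) ^ n =
      (((2 / α : ℝ) : ℂ) / (n + (2 / α : ℝ))) * z ^ n := by
    intro n
    have hpos : 0 < α * n + 2 := by positivity
    have hi : ∀ t ∈ uIoc (0 : ℝ) 1, 2 * (t : ℂ) * (z * (t ^ α : ℝ)) ^ n =
        (2 * z ^ n) * ((t ^ (α * n + 1) : ℝ) : ℂ) := by
      intro t ht
      rw [uIoc_of_le zero_le_one] at ht
      rw [Real.rpow_add ht.1, Real.rpow_mul ht.1.le, Real.rpow_one, Real.rpow_natCast]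
      push_cast
      ring
    rw [intervalIntegral.integral_congr_ae (ae_of_all _ hi), intervalIntegral.integral_const_mul,
      intervalIntegral.integral_ofReal, integral_rpow (Or.inl (by nlinarith)), Real.one_rpow,
      Real.zero_rpow (by linarith)]
    have e : (2 / α) / (n + 2 / α) = 2 * ((1 - 0) / (α * n + 1 + 1)) := by
      have : (n : ℝ) + 2 / α ≠ 0 := by positivity
      have : α * n + 1 + 1 ≠ 0 := by linarith
      field_simp
      ring
    have e' := congrArg (fun x : ℝ => (x : ℂ)) e
    push_cast at e' ⊢
    rw [e']
    ring
  rw [ordinaryHypergeometric_eq_tsum]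
  refine hsum.tsum_eq.symm.trans (tsum_congr fun n => ?_)
  rw [hterm, hypergeometric_coefficient_eq (by positivity), smul_eq_mul]

lemma isHypergeometricContinuation_eulerIntegral {α : ℝ} (hα : 0 < α) :
    IsHypergeometricContinuation 1 ((2 / α : ℝ) : ℂ) ((1 + 2 / α : ℝ) : ℂ) (eulerIntegral α) :=
  ⟨differentiableOn_eulerIntegral hα, fun _ hz =>
    eulerIntegral_eq_hypergeometric hα (mem_ball_zero_iff.1 hz)⟩

/-! ### The function `F` as a radial integral -/

/-- The integrand of the interference functional in polar coordinates. -/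
def radialKernel (α s r : ℝ) : ℝ := r / (1 + r ^ α / s)

lemma one_add_rpow_div_pos {α s r : ℝ} (hs : 0 < s) (hr : 0 ≤ r) : 0 < 1 + r ^ α / s := by
  have := Real.rpow_nonneg hr α
  positivity

lemma radialKernel_nonneg {α s r : ℝ} (hs : 0 < s) (hr : 0 ≤ r) : 0 ≤ radialKernel α s r :=
  div_nonneg hr (one_add_rpow_div_pos hs hr).le

lemma continuousOn_radialKernel {α s : ℝ} (hα : 0 < α) (hs : 0 < s) :
    ContinuousOn (radialKernel α s) (Ici 0) :=
  continuousOn_id.div (continuous_const.add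
    ((Real.continuous_rpow_const hα.le).div_const s)).continuousOn
    fun _ hr => (one_add_rpow_div_pos hs hr).ne'

/-- The argument `-x ^ α / s` is nonpositive, hence off the cut, so Euler's integral applies; the
substitution `r = x t` absorbs the factor `x ^ 2`. -/
lemma pathF_eq_integral {α s x : ℝ} (hα : 0 < α) (hs : 0 < s) (hx : 0 ≤ x) :
    pathF α s x = 2 * ∫ r in (0 : ℝ)..x, radialKernel α s r := by
  have hz : ((-(1 / s) * x ^ α : ℝ) : ℂ) ∈ hypergeometricDomain := by
    have h := Real.rpow_nonneg hx α
    have : 0 ≤ 1 / s * x ^ α := by positivity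
    left
    simp only [Complex.sub_re, Complex.one_re, Complex.ofReal_re]
    linarith
  rw [pathF, gaussHypergeometric_eq (isHypergeometricContinuation_eulerIntegral hα) hz,
    eulerIntegral]
  have hi : ∀ t ∈ uIoc (0 : ℝ) 1,
      2 * (t : ℂ) / (1 - ((-(1 / s) * x ^ α : ℝ) : ℂ) * (t ^ α : ℝ)) =
        ((2 * (t / (1 + (x * t) ^ α / s)) : ℝ) : ℂ) := by
    intro t ht
    rw [uIoc_of_le zero_le_one] at ht
    rw [Real.mul_rpow hx ht.1.le]
    push_cast
    rw [mul_div_assoc]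
    congr 2
    ring
  rw [intervalIntegral.integral_congr_ae (ae_of_all _ hi), intervalIntegral.integral_ofReal,
    Complex.ofReal_re, intervalIntegral.integral_const_mul]
  have h1 := intervalIntegral.mul_integral_comp_mul_left (a := 0) (b := 1)
    (f := radialKernel α s) x
  rw [mul_zero, mul_one] at h1
  have h2 : x * ∫ t in (0 : ℝ)..1, t / (1 + (x * t) ^ α / s) =
      ∫ t in (0 : ℝ)..1, radialKernel α s (x * t) := by
    rw [← intervalIntegral.integral_const_mul]
    refine intervalIntegral.integral_congr fun t _ => ?_
    simp only [radialKernel]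
    ring
  rw [← h1, ← h2]
  ring

/-- At `y = 0` the path loss is `∞` and both sides equal one, so no point is exceptional. -/
lemma one_sub_inv_one_add_eq {α s : ℝ} (hα : 0 < α) (hs : 0 < s) (y : Plane) :
    1 - (1 + ENNReal.ofReal s * ‖y‖ₑ ^ (-α))⁻¹ = ENNReal.ofReal (1 / (1 + ‖y‖ ^ α / s)) := by
  rcases eq_or_ne y 0 with rfl | hy
  · simp [ENNReal.zero_rpow_of_neg (neg_lt_zero.2 hα), ENNReal.mul_top, hs, Real.zero_rpow hα.ne']
  · have h0 : 0 < ‖y‖ := norm_pos_iff.2 hy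
    have h1 : 0 < ‖y‖ ^ α := Real.rpow_pos_of_pos h0 _
    rw [← ofReal_norm, ENNReal.ofReal_rpow_of_pos h0, ← ENNReal.ofReal_mul hs.le,
      ← ENNReal.ofReal_one, ← ENNReal.ofReal_add zero_le_one (by positivity),
      ← ENNReal.ofReal_inv_of_pos (by positivity), ← ENNReal.ofReal_sub _ (by positivity),
      Real.rpow_neg h0.le]
    congr 1
    field_simp
    ring

/-! ### Cluster exponents in polar coordinates -/

/-- Rotating the centre of the disk onto the nonnegative real axis makes the disk symmetric under `θ
↦ -θ`, so half of the directions suffice. -/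
lemma exists_linearIsometryEquiv_apply_eq_norm (x : Plane) :
    ∃ e : Plane ≃ₗᵢ[ℝ] ℂ, e x = (‖x‖ : ℂ) := by
  let e₀ : Plane ≃ₗᵢ[ℝ] ℂ := Complex.orthonormalBasisOneI.repr.symm
  refine ⟨e₀.trans (rotation (Circle.exp (-(e₀ x).arg))), ?_⟩
  rw [LinearIsometryEquiv.trans_apply, rotation_apply, Circle.coe_exp]
  calc _ = Complex.exp (↑(-(e₀ x).arg) * Complex.I) *
        (‖e₀ x‖ * Complex.exp ((e₀ x).arg * Complex.I)) := by
        rw [Complex.norm_mul_exp_arg_mul_I]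
    _ = _ := by
        rw [mul_left_comm, ← Complex.exp_add, e₀.norm_map]
        simp

lemma lintegral_Ioo_neg_eq_of_even {f : ℝ → ℝ≥0∞} (hf : ∀ x, f (-x) = f x) {a : ℝ} (ha : 0 ≤ a) :
    ∫⁻ x in Ioo (-a) a, f x = 2 * ∫⁻ x in Ioc 0 a, f x := by
  rw [setLIntegral_congr Ioo_ae_eq_Ioc, ← Ioc_union_Ioc_eq_Ioc (neg_nonpos.2 ha) ha,
    lintegral_union measurableSet_Ioc (Ioc_disjoint_Ioc_of_le le_rfl), two_mul]
  congr 1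
  have h := (Measure.measurePreserving_neg (volume : Measure ℝ)).setLIntegral_comp_preimage_emb
    (MeasurableEquiv.neg ℝ).measurableEmbedding f (Ioc (-a) 0)
  have hpre : Neg.neg ⁻¹' Ioc (-a) 0 = Ico 0 a := by
    ext x
    simp [and_comm]
  rw [← h]
  simp_rw [hf]
  change ∫⁻ x in Neg.neg ⁻¹' Ioc (-a) 0, f x = _
  rw [hpre, setLIntegral_congr Ico_ae_eq_Ioc]

/-- The contribution of the direction `θ` to the interference functional of a disk of radius `D`
whose centre is at distance `u` from the origin. -/
def directionExponent (α s D u θ : ℝ) : ℝ≥0∞ :=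
  ∫⁻ r in Ioi 0, {r : ℝ | r ^ 2 - 2 * r * u * Real.cos θ + u ^ 2 ≤ D ^ 2}.indicator
    (fun r => ENNReal.ofReal (radialKernel α s r)) r

lemma lintegral_closedBall_eq_polar {D : ℝ} (α s : ℝ) (hD : 0 < D) (x : Plane) :
    ∫⁻ y in Metric.closedBall x D, ENNReal.ofReal (1 / (1 + ‖y‖ ^ α / s)) =
      2 * ∫⁻ θ in Ioc 0 Real.pi, directionExponent α s D ‖x‖ θ := by
  obtain ⟨e, he⟩ := exists_linearIsometryEquiv_apply_eq_norm x
  set u := ‖x‖ with hu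
  set G : ℂ → ℝ≥0∞ := (Metric.closedBall (u : ℂ) D).indicator
    (fun z => ENNReal.ofReal (1 / (1 + ‖z‖ ^ α / s))) with hG
  have hGm : Measurable G := by
    refine Measurable.indicator ?_ Metric.isClosed_closedBall.measurableSet
    exact (measurable_const.div (measurable_const.add
      ((measurable_norm.pow_const α).div_const s))).ennreal_ofReal
  have h1 : ∫⁻ y in Metric.closedBall x D, ENNReal.ofReal (1 / (1 + ‖y‖ ^ α / s)) =
      ∫⁻ z, G z := by
    rw [← e.measurePreserving.lintegral_comp hGm,
      ← lintegral_indicator Metric.isClosed_closedBall.measurableSet]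
    refine lintegral_congr fun y => ?_
    have hmem : e y ∈ Metric.closedBall (u : ℂ) D ↔ y ∈ Metric.closedBall x D := by
      rw [Metric.mem_closedBall, Metric.mem_closedBall, ← he, e.dist_map]
    by_cases hy : y ∈ Metric.closedBall x D
    · rw [hG, indicator_of_mem hy, indicator_of_mem (hmem.2 hy), e.norm_map]
    · rw [hG, indicator_of_notMem hy, indicator_of_notMem (fun h => hy (hmem.1 h))]
  let A : Set (ℝ × ℝ) := {p | p.1 ^ 2 - 2 * p.1 * u * Real.cos p.2 + u ^ 2 ≤ D ^ 2}
  have hA : MeasurableSet A := measurableSet_le (by fun_prop) measurable_const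
  have hKm : Measurable fun r => radialKernel α s r :=
    measurable_id.div (measurable_const.add ((measurable_id.pow_const α).div_const s))
  -- Law of cosines for the distance to the centre `u`.
  have hdist : ∀ p : ℝ × ℝ, Complex.polarCoord.symm p ∈ Metric.closedBall (u : ℂ) D ↔ p ∈ A := by
    intro p
    rw [mem_closedBall_iff_norm, ← sq_le_sq₀ (norm_nonneg _) hD.le, Complex.sq_norm,
      Complex.polarCoord_symm_apply, Complex.normSq_apply]
    simp only [Complex.sub_re, Complex.mul_re, Complex.add_re, Complex.ofReal_re, Complex.I_re,
      Complex.ofReal_im, Complex.I_im, Complex.sub_im, Complex.mul_im, Complex.add_im, A,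
      mem_ofPred_eq]
    have := Real.sin_sq_add_cos_sq p.2
    have e1 : p.1 ^ 2 * (Real.sin p.2 ^ 2 + Real.cos p.2 ^ 2) = p.1 ^ 2 := by rw [this, mul_one]
    constructor <;> intro h <;> nlinarith [e1]
  rw [h1, ← Complex.lintegral_comp_polarCoord_symm]
  have h2 : ∫⁻ p in polarCoord.target, ENNReal.ofReal p.1 • G (Complex.polarCoord.symm p) =
      ∫⁻ p in polarCoord.target, A.indicator (fun p => ENNReal.ofReal (radialKernel α s p.1)) p := by
    refine setLIntegral_congr_fun polarCoord.open_target.measurableSet fun p hp => ?_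
    have hp1 : 0 < p.1 := hp.1
    by_cases hpA : p ∈ A
    · simp only [hG]
      rw [indicator_of_mem hpA, indicator_of_mem ((hdist p).2 hpA),
        Complex.norm_polarCoord_symm, abs_of_pos hp1, smul_eq_mul, ← ENNReal.ofReal_mul hp1.le,
        mul_one_div, radialKernel]
    · simp only [hG]
      rw [indicator_of_notMem hpA, indicator_of_notMem (fun h => hpA ((hdist p).1 h)), smul_zero]
  rw [h2, polarCoord_target, Measure.volume_eq_prod, ← Measure.prod_restrict,
    lintegral_prod_symm' _ (Measurable.indicator (by fun_prop) hA)]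
  exact lintegral_Ioo_neg_eq_of_even (f := directionExponent α s D u)
    (fun θ => by simp [directionExponent]) Real.pi_pos.le

/-- The constant extension to negative radii is continuous on the whole line, which gives continuity
of the primitive. -/
lemma continuous_radialKernel_max {α s : ℝ} (hα : 0 < α) (hs : 0 < s) :
    Continuous fun r => radialKernel α s (max r 0) :=
  (continuousOn_radialKernel hα hs).comp_continuous (by fun_prop) fun r => le_max_right r 0

lemma continuousOn_pathF {α s : ℝ} (hα : 0 < α) (hs : 0 < s) :
    ContinuousOn (pathF α s) (Ici 0) := by
  have hc : Continuous fun x => 2 * ∫ r in (0 : ℝ)..x, radialKernel α s (max r 0) :=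
    continuous_const.mul (intervalIntegral.continuous_primitive
      (fun a b => (continuous_radialKernel_max hα hs).intervalIntegrable a b) 0)
  refine hc.continuousOn.congr fun x hx => ?_
  rw [pathF_eq_integral hα hs hx]
  congr 1
  refine intervalIntegral.integral_congr fun r hr => ?_
  rw [uIcc_of_le hx] at hr
  simp only [max_eq_left hr.1]

lemma intervalIntegrable_radialKernel {α s c d : ℝ} (hα : 0 < α) (hs : 0 < s) (hc : 0 ≤ c)
    (hcd : c ≤ d) : IntervalIntegrable (radialKernel α s) volume c d :=
  ContinuousOn.intervalIntegrable ((continuousOn_radialKernel hα hs).mono fun r hr => by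
    rw [uIcc_of_le hcd] at hr
    exact hc.trans hr.1)

lemma lintegral_Ioc_radialKernel {α s a b : ℝ} (hα : 0 < α) (hs : 0 < s) (ha : 0 ≤ a)
    (hab : a ≤ b) :
    ∫⁻ r in Ioc a b, ENNReal.ofReal (radialKernel α s r) =
      ENNReal.ofReal ((pathF α s b - pathF α s a) / 2) := by
  have hint : ∀ {c d : ℝ}, 0 ≤ c → c ≤ d → IntervalIntegrable (radialKernel α s) volume c d :=
    intervalIntegrable_radialKernel hα hs
  rw [pathF_eq_integral hα hs ha, pathF_eq_integral hα hs (ha.trans hab), ← mul_sub,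
    mul_div_cancel_left₀ _ two_ne_zero, intervalIntegral.integral_interval_sub_left
      (hint le_rfl (ha.trans hab)) (hint le_rfl ha), intervalIntegral.integral_of_le hab,
    ofReal_integral_eq_lintegral_ofReal]
  · exact (intervalIntegrable_iff_integrableOn_Ioc_of_le hab).1 (hint ha hab)
  · filter_upwards [ae_restrict_mem measurableSet_Ioc] with r hr
    exact radialKernel_nonneg hs (ha.trans hr.1.le)

lemma pathF_mono {α s a b : ℝ} (hα : 0 < α) (hs : 0 < s) (ha : 0 ≤ a) (hab : a ≤ b) :
    pathF α s a ≤ pathF α s b := by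
  have hint : ∀ {c d : ℝ}, 0 ≤ c → c ≤ d → IntervalIntegrable (radialKernel α s) volume c d :=
    intervalIntegrable_radialKernel hα hs
  rw [pathF_eq_integral hα hs ha, pathF_eq_integral hα hs (ha.trans hab),
    ← intervalIntegral.integral_add_adjacent_intervals (hint le_rfl ha) (hint ha hab)]
  have := intervalIntegral.integral_nonneg (μ := volume) hab fun r hr =>
    radialKernel_nonneg (α := α) hs (ha.trans hr.1)
  linarith

lemma pathF_zero (α s : ℝ) : pathF α s 0 = 0 := by simp [pathF]

/-- Complete the square in `r`: the two radii are the roots. -/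
lemma quadratic_le_iff {D u r θ : ℝ} (h : 0 ≤ D ^ 2 - u ^ 2 * Real.sin θ ^ 2) :
    r ^ 2 - 2 * r * u * Real.cos θ + u ^ 2 ≤ D ^ 2 ↔
      nearRadius D u θ ≤ r ∧ r ≤ farRadius D u θ := by
  have key : r ^ 2 - 2 * r * u * Real.cos θ + u ^ 2 ≤ D ^ 2 ↔
      (r - u * Real.cos θ) ^ 2 ≤ D ^ 2 - u ^ 2 * Real.sin θ ^ 2 := by
    have e1 : u ^ 2 * Real.sin θ ^ 2 = u ^ 2 - u ^ 2 * Real.cos θ ^ 2 := by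
      rw [Real.sin_sq]; ring
    rw [e1]
    constructor <;> intro h <;> nlinarith
  rw [key, Real.sq_le h, nearRadius, farRadius]
  constructor <;> rintro ⟨h1, h2⟩ <;> constructor <;> linarith

lemma abs_mul_cos_le_sqrt {D u : ℝ} (hu : 0 ≤ u) (huD : u ≤ D) (θ : ℝ) :
    |u * Real.cos θ| ≤ √(D ^ 2 - u ^ 2 * Real.sin θ ^ 2) := by
  refine Real.abs_le_sqrt ?_
  rw [Real.sin_sq]
  nlinarith

/-- The origin lies in the disk, so the roots satisfy `nearRadius ≤ 0 ≤ farRadius` and every ray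
stays in the disk from `0` to `farRadius`. -/
lemma directionExponent_of_le {α s D u : ℝ} (hα : 0 < α) (hs : 0 < s) (hu : 0 ≤ u) (huD : u ≤ D)
    (θ : ℝ) :
    directionExponent α s D u θ = ENNReal.ofReal (pathF α s (farRadius D u θ) / 2) := by
  have habs := abs_le.1 (abs_mul_cos_le_sqrt hu huD θ)
  have hnear : nearRadius D u θ ≤ 0 := by rw [nearRadius]; linarith
  have hfar : 0 ≤ farRadius D u θ := by rw [farRadius]; linarith
  have hdisc : 0 ≤ D ^ 2 - u ^ 2 * Real.sin θ ^ 2 := by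
    rw [Real.sin_sq]
    nlinarith [mul_nonneg (sq_nonneg u) (sq_nonneg (Real.cos θ))]
  have hset : MeasurableSet {r : ℝ | r ^ 2 - 2 * r * u * Real.cos θ + u ^ 2 ≤ D ^ 2} :=
    measurableSet_le (by fun_prop) measurable_const
  have h := lintegral_Ioc_radialKernel hα hs le_rfl hfar
  rw [pathF_zero, sub_zero] at h
  rw [directionExponent, setLIntegral_indicator hset, ← h]
  congr 2
  ext r
  simp only [mem_inter_iff, mem_ofPred_eq, quadratic_le_iff hdisc, mem_Ioi, mem_Ioc]
  exact ⟨fun h => ⟨h.2, h.1.2⟩, fun h => ⟨⟨hnear.trans h.1.le, h.2⟩, h.1⟩⟩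

lemma sin_le_of_le_arcsin {D u θ : ℝ} (hD : 0 < D) (hu : D < u) (h0 : 0 ≤ θ)
    (hθ : θ ≤ Real.arcsin (D / u)) : u * Real.sin θ ≤ D ∧ 0 < Real.cos θ := by
  have hu0 : 0 < u := hD.trans hu
  have hlt : Real.arcsin (D / u) < Real.pi / 2 := by
    rw [Real.arcsin_lt_pi_div_two, div_lt_one hu0]
    exact hu
  refine ⟨?_, Real.cos_pos_of_mem_Ioo ⟨by linarith [Real.pi_pos], hθ.trans_lt hlt⟩⟩
  have := (Real.le_arcsin_iff_sin_le ⟨by linarith [Real.pi_pos], by linarith⟩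
    ⟨by have := div_pos hD hu0; linarith, ((div_lt_one hu0).2 hu).le⟩).1 hθ
  rwa [le_div_iff₀ hu0, mul_comm] at this

lemma nearRadius_pos {D u θ : ℝ} (hD : 0 < D) (hu : D < u) (h0 : 0 ≤ θ)
    (hθ : θ ≤ Real.arcsin (D / u)) : 0 < nearRadius D u θ := by
  obtain ⟨-, hc⟩ := sin_le_of_le_arcsin hD hu h0 hθ
  have hu0 : 0 < u := hD.trans hu
  rw [nearRadius, sub_pos, Real.sqrt_lt' (mul_pos hu0 hc), Real.sin_sq]
  nlinarith

lemma directionExponent_of_lt {α s D u θ : ℝ} (hα : 0 < α) (hs : 0 < s) (hD : 0 < D) (hu : D < u)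
    (h0 : 0 ≤ θ) (hθ : θ ≤ Real.arcsin (D / u)) :
    directionExponent α s D u θ =
      ENNReal.ofReal ((pathF α s (farRadius D u θ) - pathF α s (nearRadius D u θ)) / 2) := by
  obtain ⟨hsin, -⟩ := sin_le_of_le_arcsin hD hu h0 hθ
  have hu0 : 0 < u := hD.trans hu
  have hnear := nearRadius_pos hD hu h0 hθ
  have hs0 : 0 ≤ Real.sin θ := Real.sin_nonneg_of_nonneg_of_le_pi h0
    (hθ.trans ((Real.arcsin_le_pi_div_two _).trans (by linarith [Real.pi_pos])))
  have hdisc : 0 ≤ D ^ 2 - u ^ 2 * Real.sin θ ^ 2 := by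
    nlinarith [mul_nonneg hu0.le hs0]
  have hle : nearRadius D u θ ≤ farRadius D u θ := by
    rw [nearRadius, farRadius]
    linarith [Real.sqrt_nonneg (D ^ 2 - u ^ 2 * Real.sin θ ^ 2)]
  have hset : MeasurableSet {r : ℝ | r ^ 2 - 2 * r * u * Real.cos θ + u ^ 2 ≤ D ^ 2} :=
    measurableSet_le (by fun_prop) measurable_const
  rw [directionExponent, setLIntegral_indicator hset,
    ← lintegral_Ioc_radialKernel hα hs hnear.le hle, setLIntegral_congr Ioc_ae_eq_Icc]
  congr 2
  ext r
  simp only [mem_inter_iff, mem_ofPred_eq, quadratic_le_iff hdisc, mem_Ioi, mem_Icc]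
  exact ⟨fun h => h.1, fun h => ⟨h, hnear.trans_le h.1⟩⟩

/-- The ray misses the disk. Up to `π / 2` the quadratic has negative discriminant; beyond, `cos θ ≤
0` and the left side is at least `u ^ 2 > D ^ 2`. -/
lemma directionExponent_eq_zero {α s D u θ : ℝ} (hD : 0 < D) (hu : D < u)
    (h0 : 0 ≤ θ) (hπ : θ ≤ Real.pi) (hθ : Real.arcsin (D / u) < θ) :
    directionExponent α s D u θ = 0 := by
  have hu0 : 0 < u := hD.trans hu
  have hset : MeasurableSet {r : ℝ | r ^ 2 - 2 * r * u * Real.cos θ + u ^ 2 ≤ D ^ 2} :=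
    measurableSet_le (by fun_prop) measurable_const
  rw [directionExponent, setLIntegral_indicator hset]
  suffices h : {r : ℝ | r ^ 2 - 2 * r * u * Real.cos θ + u ^ 2 ≤ D ^ 2} ∩ Ioi 0 = ∅ by
    rw [h, setLIntegral_empty]
  refine eq_empty_of_forall_notMem fun r hr => ?_
  obtain ⟨hr1, hr0⟩ : r ^ 2 - 2 * r * u * Real.cos θ + u ^ 2 ≤ D ^ 2 ∧ 0 < r := by
    simpa using hr
  rcases le_or_gt θ (Real.pi / 2) with h | h
  · have h1 : D / u < Real.sin θ := by
      have h1 : D / u ≤ 1 := ((div_lt_one hu0).2 hu).le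
      have h2 : -1 ≤ D / u := by linarith [div_pos hD hu0]
      exact (Real.arcsin_lt_iff_lt_sin ⟨h2, h1⟩ ⟨by linarith [Real.pi_pos], h⟩).1 hθ
    rw [div_lt_iff₀ hu0] at h1
    have h2 : D ^ 2 < (Real.sin θ * u) ^ 2 := pow_lt_pow_left₀ h1 hD.le two_ne_zero
    have h3 : (Real.sin θ * u) ^ 2 = u ^ 2 - u ^ 2 * Real.cos θ ^ 2 := by
      rw [mul_pow, Real.sin_sq]; ring
    nlinarith [sq_nonneg (r - u * Real.cos θ)]
  · have hc : Real.cos θ ≤ 0 := Real.cos_nonpos_of_pi_div_two_le_of_le h.le (by linarith)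
    nlinarith [mul_nonneg (mul_pos hr0 hu0).le (neg_nonneg.2 hc), sq_nonneg r]

lemma two_mul_lintegral_ofReal_half {f : ℝ → ℝ} {a : ℝ} (ha : 0 ≤ a)
    (hf : ContinuousOn f (Icc 0 a)) (h0 : ∀ θ ∈ Icc 0 a, 0 ≤ f θ) :
    2 * ∫⁻ θ in Ioc 0 a, ENNReal.ofReal (f θ / 2) = ENNReal.ofReal (∫ θ in (0 : ℝ)..a, f θ) := by
  have hint : IntegrableOn f (Ioc 0 a) :=
    (hf.integrableOn_compact isCompact_Icc).mono_set Ioc_subset_Icc_self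
  rw [intervalIntegral.integral_of_le ha, ofReal_integral_eq_lintegral_ofReal hint,
    ← lintegral_const_mul' _ _ (by simp)]
  · refine lintegral_congr fun θ => ?_
    rw [← ENNReal.ofReal_ofNat, ← ENNReal.ofReal_mul (by norm_num)]
    congr 1
    ring
  · filter_upwards [ae_restrict_mem measurableSet_Ioc] with θ hθ
    exact h0 θ (Ioc_subset_Icc_self hθ)

lemma continuous_farRadius (D u : ℝ) : Continuous (farRadius D u) := by
  unfold farRadius; fun_prop

lemma continuous_nearRadius (D u : ℝ) : Continuous (nearRadius D u) := by
  unfold nearRadius; fun_prop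

lemma clusterExponent_eq_polar {α lam D s : ℝ} (hα : 0 < α) (hD : 0 < D) (hs : 0 < s) (x : Plane) :
    clusterExponent α lam D (ENNReal.ofReal s) x = ENNReal.ofReal lam *
      (2 * ∫⁻ θ in Ioc 0 Real.pi, directionExponent α s D ‖x‖ θ) := by
  rw [clusterExponent, ← lintegral_closedBall_eq_polar α s hD]
  simp_rw [one_sub_inv_one_add_eq hα hs]

lemma clusterExponent_of_norm_le {α lam D s : ℝ} (hα : 0 < α) (hlam : 0 < lam) (hD : 0 < D)
    (hs : 0 < s) {x : Plane} (hx : ‖x‖ ≤ D) :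
    clusterExponent α lam D (ENNReal.ofReal s) x =
        ENNReal.ofReal (lam * insideExponent α D s ‖x‖) ∧ 0 ≤ insideExponent α D s ‖x‖ := by
  have hfar : ∀ θ, 0 ≤ farRadius D ‖x‖ θ := fun θ => by
    have := abs_le.1 (abs_mul_cos_le_sqrt (norm_nonneg x) hx θ)
    rw [farRadius]
    linarith
  have hF : ∀ θ, 0 ≤ pathF α s (farRadius D ‖x‖ θ) := fun θ => by
    simpa [pathF_zero] using pathF_mono hα hs le_rfl (hfar θ)
  have hcont : Continuous fun θ => pathF α s (farRadius D ‖x‖ θ) :=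
    (continuousOn_pathF hα hs).comp_continuous (continuous_farRadius D ‖x‖) hfar
  refine ⟨?_, intervalIntegral.integral_nonneg Real.pi_pos.le fun θ _ => hF θ⟩
  rw [clusterExponent_eq_polar hα hD hs, ENNReal.ofReal_mul hlam.le, insideExponent,
    ← two_mul_lintegral_ofReal_half Real.pi_pos.le hcont.continuousOn fun θ _ => hF θ]
  simp_rw [directionExponent_of_le hα hs (norm_nonneg x) hx]

lemma clusterExponent_of_lt_norm {α lam D s : ℝ} (hα : 0 < α) (hlam : 0 < lam) (hD : 0 < D)
    (hs : 0 < s) {x : Plane} (hx : D < ‖x‖) :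
    clusterExponent α lam D (ENNReal.ofReal s) x =
        ENNReal.ofReal (lam * outsideExponent α D s ‖x‖) ∧ 0 ≤ outsideExponent α D s ‖x‖ := by
  set φ := Real.arcsin (D / ‖x‖) with hφ
  have hφ0 : 0 ≤ φ := Real.arcsin_nonneg.2 (by positivity)
  have hφπ : φ ≤ Real.pi := (Real.arcsin_le_pi_div_two _).trans (by linarith [Real.pi_pos])
  have hnear : ∀ θ ∈ Icc 0 φ, 0 ≤ nearRadius D ‖x‖ θ := fun θ hθ =>
    (nearRadius_pos hD hx hθ.1 hθ.2).le
  have hle : ∀ θ, nearRadius D ‖x‖ θ ≤ farRadius D ‖x‖ θ := fun θ => by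
    rw [nearRadius, farRadius]
    linarith [Real.sqrt_nonneg (D ^ 2 - ‖x‖ ^ 2 * Real.sin θ ^ 2)]
  have hF : ∀ θ ∈ Icc 0 φ,
      0 ≤ pathF α s (farRadius D ‖x‖ θ) - pathF α s (nearRadius D ‖x‖ θ) := fun θ hθ =>
    sub_nonneg.2 (pathF_mono hα hs (hnear θ hθ) (hle θ))
  have hcont : ContinuousOn
      (fun θ => pathF α s (farRadius D ‖x‖ θ) - pathF α s (nearRadius D ‖x‖ θ)) (Icc 0 φ) :=
    ((continuousOn_pathF hα hs).comp (continuous_farRadius D ‖x‖).continuousOn fun θ hθ =>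
      (hnear θ hθ).trans (hle θ)).sub
    ((continuousOn_pathF hα hs).comp (continuous_nearRadius D ‖x‖).continuousOn hnear)
  refine ⟨?_, intervalIntegral.integral_nonneg hφ0 hF⟩
  rw [clusterExponent_eq_polar hα hD hs, ENNReal.ofReal_mul hlam.le, outsideExponent,
    ← two_mul_lintegral_ofReal_half hφ0 hcont hF]
  congr 2
  -- Only directions up to the tangent angle `φ` contribute.
  rw [← Ioc_union_Ioc_eq_Ioc hφ0 hφπ,
    lintegral_union measurableSet_Ioc (Ioc_disjoint_Ioc_of_le le_rfl),
    setLIntegral_congr_fun measurableSet_Ioc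
      (fun θ hθ => directionExponent_of_lt (s := s) hα hs hD hx hθ.1.le hθ.2),
    setLIntegral_congr_fun (g := fun _ => 0) measurableSet_Ioc
      (fun θ hθ => directionExponent_eq_zero hD hx (hφ0.trans hθ.1.le) hθ.2 hθ.1)]
  simp [hφ]

/-! ### Integrability of the path loss and of the cluster exponent -/

lemma lintegral_one_div_one_add_lt_top {α s : ℝ} (hα : 2 < α) (hs : 0 < s) :
    ∫⁻ y : Plane, ENNReal.ofReal (1 / (1 + ‖y‖ ^ α / s)) < ∞ := by
  -- Comparison with `(1 + r) ^ (-α)`, integrable on the plane as `α > 2`. The factors come from `(1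
  -- + r) ^ α ≤ 2 ^ α (1 + r ^ α)` and `1 + r ^ α ≤ max 1 s * (1 + r ^ α / s)`.
  set C : ℝ := 2 ^ α * max 1 s with hC
  have hfin : ∫⁻ y : Plane, ENNReal.ofReal ((1 + ‖y‖) ^ (-α)) < ∞ :=
    finite_integral_one_add_norm (by simpa using hα)
  have hle : ∀ y : Plane, ENNReal.ofReal (1 / (1 + ‖y‖ ^ α / s)) ≤
      ENNReal.ofReal C * ENNReal.ofReal ((1 + ‖y‖) ^ (-α)) := by
    intro y
    have hr := norm_nonneg y
    set r := ‖y‖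
    have hα0 : 0 < α := by linarith
    have h2 : (1 + r) ^ α ≤ 2 ^ α * (1 + r ^ α) := by
      have h3 : (1 + r) ^ α ≤ (2 * max 1 r) ^ α :=
        Real.rpow_le_rpow (by positivity)
          (by linarith [le_max_left 1 r, le_max_right 1 r]) hα0.le
      rw [Real.mul_rpow zero_le_two (by positivity)] at h3
      refine h3.trans (mul_le_mul_of_nonneg_left ?_ (by positivity))
      have h0 := Real.rpow_nonneg hr α
      rcases max_cases 1 r with ⟨h, -⟩ | ⟨h, -⟩ <;> rw [h]
      · rw [Real.one_rpow]; linarith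
      · linarith
    have h4 : 1 + r ^ α ≤ max 1 s * (1 + r ^ α / s) := by
      have h0 := Real.rpow_nonneg hr α
      have h5 : r ^ α ≤ max 1 s * (r ^ α / s) := by
        calc r ^ α = s * (r ^ α / s) := by field_simp
          _ ≤ _ := mul_le_mul_of_nonneg_right (le_max_right _ _) (by positivity)
      linarith [le_max_left 1 s]
    rw [← ENNReal.ofReal_mul (by positivity)]
    refine ENNReal.ofReal_le_ofReal ?_
    have h6 : 0 < (1 + r) ^ α := by positivity
    rw [Real.rpow_neg (by positivity), ← div_eq_mul_inv,
      div_le_div_iff₀ (one_add_rpow_div_pos hs hr) h6, one_mul, hC, mul_assoc]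
    exact h2.trans (mul_le_mul_of_nonneg_left h4 (by positivity))
  refine (lintegral_mono hle).trans_lt ?_
  rw [lintegral_const_mul' _ _ ENNReal.ofReal_ne_top]
  exact ENNReal.mul_lt_top ENNReal.ofReal_lt_top hfin

/-- Along `s = 1 / (n + 1)` the integrand is dominated by its value at `s = 1` and tends to zero
except at the origin. -/
lemma tendsto_lintegral_one_div_one_add {α : ℝ} (hα : 2 < α) :
    Tendsto (fun n : ℕ => ∫⁻ y : Plane, ENNReal.ofReal (1 / (1 + ‖y‖ ^ α / (1 / ((n : ℝ) + 1)))))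
      atTop (𝓝 0) := by
  have h := tendsto_lintegral_of_dominated_convergence (μ := (volume : Measure Plane))
    (F := fun (n : ℕ) y => ENNReal.ofReal (1 / (1 + ‖y‖ ^ α / (1 / ((n : ℝ) + 1)))))
    (f := fun _ => 0) (fun y => ENNReal.ofReal (1 / (1 + ‖y‖ ^ α / 1)))
    (fun n => (measurable_const.div (measurable_const.add
      ((measurable_norm.pow_const α).div_const _))).ennreal_ofReal)
    (fun n => ae_of_all _ fun y => by
      have h0 := Real.rpow_nonneg (norm_nonneg y) α
      refine ENNReal.ofReal_le_ofReal (one_div_le_one_div_of_le (by positivity) ?_)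
      rw [div_one, div_div_eq_mul_div, div_one]
      have : 0 ≤ (n : ℝ) := n.cast_nonneg
      nlinarith)
    (lintegral_one_div_one_add_lt_top hα one_pos).ne
    (by
      filter_upwards [Measure.ae_ne volume (0 : Plane)] with y hy
      have h0 : 0 < ‖y‖ ^ α := Real.rpow_pos_of_pos (norm_pos_iff.2 hy) _
      rw [← ENNReal.ofReal_zero]
      refine (ENNReal.continuous_ofReal.tendsto _).comp ?_
      simp_rw [div_div_eq_mul_div, div_one]
      refine tendsto_const_nhds.div_atTop (tendsto_atTop_add_const_left _ _ ?_)
      exact (tendsto_atTop_add_const_right _ _ tendsto_natCast_atTop_atTop).const_mul_atTop h0)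
  simpa using h

/-- Tonelli: the centres whose disk contains a given `y` form a disk of the same radius about `y`.
-/
lemma lintegral_clusterExponent {α s : ℝ} (hα : 0 < α) (hs : 0 < s) (lam D : ℝ) :
    ∫⁻ x, clusterExponent α lam D (ENNReal.ofReal s) x =
      ENNReal.ofReal lam * volume (Metric.closedBall (0 : Plane) D) *
        ∫⁻ y : Plane, ENNReal.ofReal (1 / (1 + ‖y‖ ^ α / s)) := by
  set q : Plane → ℝ≥0∞ := fun y => ENNReal.ofReal (1 / (1 + ‖y‖ ^ α / s)) with hq
  have hqm : Measurable q := (measurable_const.div (measurable_const.add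
    ((measurable_norm.pow_const α).div_const _))).ennreal_ofReal
  let A : Set (Plane × Plane) := {p | dist p.2 p.1 ≤ D}
  have hA : MeasurableSet A := measurableSet_le (measurable_snd.dist measurable_fst) measurable_const
  have h1 : ∀ x, clusterExponent α lam D (ENNReal.ofReal s) x =
      ENNReal.ofReal lam * ∫⁻ y, A.indicator (fun p => q p.2) (x, y) := by
    intro x
    rw [clusterExponent, ← lintegral_indicator Metric.isClosed_closedBall.measurableSet]
    congr 1
    refine lintegral_congr fun y => ?_
    simp only [indicator, one_sub_inv_one_add_eq hα hs, q]
    rfl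
  have hm : Measurable (A.indicator fun p => q p.2) := (hqm.comp measurable_snd).indicator hA
  simp_rw [h1]
  rw [lintegral_const_mul' _ _ ENNReal.ofReal_ne_top,
    lintegral_lintegral_swap (f := fun x y => A.indicator (fun p => q p.2) (x, y)) hm.aemeasurable,
    mul_assoc, ← lintegral_const_mul _ hqm]
  congr 1
  refine lintegral_congr fun y => ?_
  have h2 : ∀ x, A.indicator (fun p => q p.2) (x, y) =
      (Metric.closedBall y D).indicator (fun _ => q y) x := by
    intro x
    simp only [indicator, A, mem_ofPred_eq, Metric.mem_closedBall, dist_comm x y]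
  simp_rw [h2]
  rw [lintegral_indicator_const Metric.isClosed_closedBall.measurableSet, mul_comm,
    Measure.addHaar_closedBall_center]

lemma lintegral_one_sub_expNeg_clusterExponent_le {α s : ℝ} (hα : 0 < α) (hs : 0 < s) (lam D : ℝ) :
    ∫⁻ x, (1 - expNeg (clusterExponent α lam D (ENNReal.ofReal s) x)) ≤
      ENNReal.ofReal lam * volume (Metric.closedBall (0 : Plane) D) *
        ∫⁻ y : Plane, ENNReal.ofReal (1 / (1 + ‖y‖ ^ α / s)) := by
  rw [← lintegral_clusterExponent hα hs]
  exact lintegral_mono fun x => one_sub_expNeg_le _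

/-! ### Almost sure finiteness and the real Laplace transform -/

section

variable {Ω : Type*} [MeasurableSpace Ω] {P : Measure Ω} [IsProbabilityMeasure P]
  {α lamP lam D : ℝ} {X : ℕ → Ω → Plane} {N : ℕ → Ω → ℕ} {Y : ℕ → ℕ → Ω → Plane}
  {h : ℕ → ℕ → Ω → ℝ}

/-- The interference of a Matérn cluster process is almost surely finite. -/
theorem IsMaternClusterProcess.ae_interCluster_lt_top (hα : 2 < α)
    (hΦ : IsMaternClusterProcess P lamP lam D X N Y) (hh : IsRayleighFading P X N Y h) :
    ∀ᵐ ω ∂P, interCluster α N Y h ω < ∞ := by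
  have hα0 : 0 < α := by linarith
  have hm : Measurable (interCluster α N Y h) := measurable_interCluster α hΦ.measurable_num
    hΦ.measurable_offspring hh.measurable_gain
  have hset : MeasurableSet {ω | interCluster α N Y h ω < ∞} := measurableSet_lt hm measurable_const
  rw [ae_iff_prob_eq_one (by fun_prop)]
  refine le_antisymm prob_le_one ?_
  set C := ENNReal.ofReal lamP *
    (ENNReal.ofReal lam * volume (Metric.closedBall (0 : Plane) D)) with hC
  have hCtop : C ≠ ∞ := ENNReal.mul_ne_top ENNReal.ofReal_ne_top
    (ENNReal.mul_ne_top ENNReal.ofReal_ne_top measure_closedBall_lt_top.ne)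
  -- For `s > 0`, `exp (-s I)` is at most the indicator of `I < ∞`. Its mean is bounded below by a
  -- quantity tending to one as `s → 0`, so that event has probability one.
  have hlim := (continuous_expNeg.tendsto _).comp
    (ENNReal.Tendsto.const_mul (tendsto_lintegral_one_div_one_add hα) (Or.inr hCtop))
  rw [mul_zero, expNeg_zero] at hlim
  refine le_of_tendsto hlim (Eventually.of_forall fun n => ?_)
  have hs : (0 : ℝ) < 1 / ((n : ℝ) + 1) := by positivity
  set s : ℝ := 1 / ((n : ℝ) + 1) with hsdef
  calc expNeg (C * ∫⁻ y : Plane, ENNReal.ofReal (1 / (1 + ‖y‖ ^ α / s)))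
      ≤ expNeg (ENNReal.ofReal lamP *
          ∫⁻ x, (1 - expNeg (clusterExponent α lam D (ENNReal.ofReal s) x))) := by
        refine antitone_expNeg ?_
        rw [hC, mul_assoc]
        exact mul_le_mul_right (lintegral_one_sub_expNeg_clusterExponent_le hα0 hs lam D) _
    _ = ∫⁻ ω, expNeg (ENNReal.ofReal s * interCluster α N Y h ω) ∂P :=
        (hΦ.lintegral_expNeg_interCluster hh α _).symm
    _ ≤ ∫⁻ ω, {ω | interCluster α N Y h ω < ∞}.indicator 1 ω ∂P := by
        refine lintegral_mono fun ω => ?_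
        by_cases hω : interCluster α N Y h ω < ∞
        · rw [indicator_of_mem (by exact hω)]
          exact expNeg_le_one _
        · rw [not_lt, top_le_iff] at hω
          simp [hω, ENNReal.mul_top, hs]
    _ = P {ω | interCluster α N Y h ω < ∞} := lintegral_indicator_one hset

/-- The Laplace transform of the interference as an integral over the location of a parent. -/
theorem IsMaternClusterProcess.integral_exp_interCluster (hα : 2 < α) (hlamP : 0 ≤ lamP)
    (hΦ : IsMaternClusterProcess P lamP lam D X N Y) (hh : IsRayleighFading P X N Y h)
    {s : ℝ} (hs : 0 < s) :
    ∫ ω, Real.exp (-s * (interCluster α N Y h ω).toReal) ∂P =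
      Real.exp (-(lamP *
        (∫⁻ x, (1 - expNeg (clusterExponent α lam D (ENNReal.ofReal s) x))).toReal)) := by
  have hα0 : 0 < α := by linarith
  have hm : Measurable (interCluster α N Y h) := measurable_interCluster α hΦ.measurable_num
    hΦ.measurable_offspring hh.measurable_gain
  set A := ∫⁻ x, (1 - expNeg (clusterExponent α lam D (ENNReal.ofReal s) x)) with hA
  have hAtop : A ≠ ∞ := ((lintegral_one_sub_expNeg_clusterExponent_le hα0 hs lam D).trans_lt
    (ENNReal.mul_lt_top (ENNReal.mul_lt_top ENNReal.ofReal_lt_top measure_closedBall_lt_top)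
      (lintegral_one_div_one_add_lt_top hα hs))).ne
  rw [integral_eq_lintegral_of_nonneg_ae (ae_of_all _ fun ω => (Real.exp_pos _).le)
    (Real.measurable_exp.comp (hm.ennreal_toReal.const_mul (-s))).aestronglyMeasurable]
  have h1 : ∫⁻ ω, ENNReal.ofReal (Real.exp (-s * (interCluster α N Y h ω).toReal)) ∂P =
      ∫⁻ ω, expNeg (ENNReal.ofReal s * interCluster α N Y h ω) ∂P := by
    refine lintegral_congr_ae ?_
    -- Finiteness matters: `toReal` sends `∞` to `0`, where the real exponential would be `1`
    -- instead of `0`.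
    filter_upwards [hΦ.ae_interCluster_lt_top hα hh] with ω hω
    conv_rhs => rw [← ENNReal.ofReal_toReal hω.ne, ← ENNReal.ofReal_mul hs.le]
    rw [expNeg_ofReal (by positivity), neg_mul]
  rw [h1, hΦ.lintegral_expNeg_interCluster hh α, ← hA, ← ENNReal.ofReal_toReal hAtop,
    ← ENNReal.ofReal_mul hlamP, expNeg_ofReal (by positivity),
    ENNReal.toReal_ofReal (Real.exp_pos _).le, ENNReal.toReal_ofReal ENNReal.toReal_nonneg]

end

/-! ### Reduction to radial integrals -/

/-- The function `u ↦ 1 - 𝔼 exp (-s I)` where `I` is the interference of a cluster whose parent is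
at distance `u` from the origin. -/
def radialExponent (α lam D s u : ℝ) : ℝ :=
  if u ≤ D then 1 - Real.exp (-lam * insideExponent α D s u)
  else 1 - Real.exp (-lam * outsideExponent α D s u)

lemma one_sub_expNeg_clusterExponent_eq {α lam D s : ℝ} (hα : 0 < α) (hlam : 0 < lam) (hD : 0 < D)
    (hs : 0 < s) (x : Plane) :
    1 - expNeg (clusterExponent α lam D (ENNReal.ofReal s) x) =
      ENNReal.ofReal (radialExponent α lam D s ‖x‖) ∧ 0 ≤ radialExponent α lam D s ‖x‖ := by
  have key : ∀ t : ℝ, 0 ≤ t → 1 - expNeg (ENNReal.ofReal (lam * t)) =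
      ENNReal.ofReal (1 - Real.exp (-lam * t)) ∧ 0 ≤ 1 - Real.exp (-lam * t) := by
    intro t ht
    have h0 : 0 ≤ lam * t := by positivity
    rw [expNeg_ofReal h0, ← ENNReal.ofReal_one, ← ENNReal.ofReal_sub _ (Real.exp_pos _).le, neg_mul]
    exact ⟨rfl, sub_nonneg.2 (Real.exp_le_one_iff.2 (by linarith))⟩
  rw [radialExponent]
  split_ifs with hx
  · obtain ⟨h1, h2⟩ := clusterExponent_of_norm_le hα hlam hD hs hx
    rw [h1]
    exact key _ h2
  · obtain ⟨h1, h2⟩ := clusterExponent_of_lt_norm hα hlam hD hs (not_le.1 hx)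
    rw [h1]
    exact key _ h2

lemma integrable_radialExponent {α lam D s : ℝ} (hα : 2 < α) (hlam : 0 < lam) (hD : 0 < D)
    (hs : 0 < s) :
    Integrable (fun x : Plane => radialExponent α lam D s ‖x‖) ∧
    (∫⁻ x, (1 - expNeg (clusterExponent α lam D (ENNReal.ofReal s) x))).toReal =
      ∫ x : Plane, radialExponent α lam D s ‖x‖ := by
  have hα0 : 0 < α := by linarith
  have key := one_sub_expNeg_clusterExponent_eq hα0 hlam hD hs
  -- Measurability is inherited from `clusterExponent`, avoiding a direct study of the angular
  -- integrals as functions of `u`.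
  have hm : Measurable fun x : Plane => radialExponent α lam D s ‖x‖ := by
    have : (fun x : Plane => radialExponent α lam D s ‖x‖) = fun x =>
        (1 - expNeg (clusterExponent α lam D (ENNReal.ofReal s) x)).toReal := by
      ext x
      rw [(key x).1, ENNReal.toReal_ofReal (key x).2]
    rw [this]
    exact (measurable_const.sub
      (measurable_expNeg.comp (measurable_clusterExponent α lam D _))).ennreal_toReal
  have hfin := (lintegral_one_sub_expNeg_clusterExponent_le hα0 hs lam D).trans_lt
    (ENNReal.mul_lt_top (ENNReal.mul_lt_top ENNReal.ofReal_lt_top measure_closedBall_lt_top)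
      (lintegral_one_div_one_add_lt_top hα hs))
  simp_rw [fun x => (key x).1] at hfin ⊢
  refine ⟨(lintegral_ofReal_ne_top_iff_integrable hm.aestronglyMeasurable
    (ae_of_all _ fun x => (key x).2)).1 hfin.ne, ?_⟩
  rw [integral_eq_lintegral_of_nonneg_ae (ae_of_all _ fun x => (key x).2) hm.aestronglyMeasurable]

end

theorem theorem3 {Ω : Type*} [MeasurableSpace Ω] (P : Measure Ω) [IsProbabilityMeasure P]
    (α lamP lam D : ℝ) (hα : 2 < α) (hlamP : 0 < lamP) (hlam : 0 < lam) (hD : 0 < D)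
    (X : ℕ → Ω → Plane) (N : ℕ → Ω → ℕ) (Y : ℕ → ℕ → Ω → Plane) (h : ℕ → ℕ → Ω → ℝ)
    (hΦ : IsMaternClusterProcess P lamP lam D X N Y)
    (hh : IsRayleighFading P X N Y h) :
    (∀ᵐ ω ∂P, interCluster α N Y h ω < ∞) ∧
    ∀ s : ℝ, 0 < s →
      IntegrableOn (fun u => (1 - Real.exp (-lam * insideExponent α D s u)) * u)
        (Ioc 0 D) ∧
      IntegrableOn (fun u => (1 - Real.exp (-lam * outsideExponent α D s u)) * u)
        (Ioi D) ∧
      ∫ ω, Real.exp (-s * (interCluster α N Y h ω).toReal) ∂P =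
        Real.exp (-2 * Real.pi * lamP *
          ((∫ u in (0 : ℝ)..D, (1 - Real.exp (-lam * insideExponent α D s u)) * u) +
            ∫ u in Ioi D, (1 - Real.exp (-lam * outsideExponent α D s u)) * u)) := by
  have hα0 : 0 < α := by linarith
  refine ⟨hΦ.ae_interCluster_lt_top hα hh, fun s hs => ?_⟩
  obtain ⟨hint, heq⟩ := integrable_radialExponent hα hlam hD hs
  have hdim : Module.finrank ℝ Plane = 2 := by simp
  have hball : volume.real (Metric.ball (0 : Plane) 1) = Real.pi := by
    rw [measureReal_def, EuclideanSpace.volume_ball_fin_two]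
    simp [Real.pi_pos.le]
  -- Integrability of a radial function on the plane is integrability against `u du`; the constant
  -- `2π` is the dimension times the area of the unit disk.
  have hrad : IntegrableOn (fun u => radialExponent α lam D s u * u) (Ioi 0) := by
    refine ((integrable_fun_norm_addHaar volume).1 hint).congr_fun (fun u _ => ?_)
      measurableSet_Ioi
    simp [hdim, mul_comm]
  have hin : EqOn (fun u => radialExponent α lam D s u * u)
      (fun u => (1 - Real.exp (-lam * insideExponent α D s u)) * u) (Ioc 0 D) := fun u hu => by
    simp only [radialExponent, if_pos hu.2]
  have hout : EqOn (fun u => radialExponent α lam D s u * u)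
      (fun u => (1 - Real.exp (-lam * outsideExponent α D s u)) * u) (Ioi D) := fun u hu => by
    simp only [radialExponent, if_neg (not_le.2 (mem_Ioi.1 hu))]
  have hI1 := hrad.mono_set (Ioc_subset_Ioi_self : Ioc 0 D ⊆ Ioi 0)
  have hI2 := hrad.mono_set (Ioi_subset_Ioi hD.le)
  refine ⟨hI1.congr_fun hin measurableSet_Ioc, hI2.congr_fun hout measurableSet_Ioi, ?_⟩
  rw [hΦ.integral_exp_interCluster hα hlamP.le hh hs, heq, integral_fun_norm_addHaar, hdim, hball,
    intervalIntegral.integral_of_le hD.le, ← setIntegral_congr_fun measurableSet_Ioc hin,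
    ← setIntegral_congr_fun measurableSet_Ioi hout,
    ← setIntegral_union (Ioc_disjoint_Ioi le_rfl) measurableSet_Ioi hI1 hI2,
    Ioc_union_Ioi_eq_Ioi hD.le]
  congr 1
  simp only [Nat.add_one_sub_one, pow_one, smul_eq_mul, nsmul_eq_mul, Nat.cast_ofNat,
    mul_comm (radialExponent _ _ _ _ _)]
  ring
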